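/- **Setting.** Let $(\mathcal X,\mathcal B,\mu)$ be a probability space and let $(P_t)_{t\ge 0}$ be a symmetric Markov semigroup on $L^2(\mu)$ (strongly continuous, positivity preserving, $P_t1=1$, each $P_t$ symmetric), with self-adjoint generator $L$ and domain $\mathcal D(L)$. Let $\mathcal A\subset\mathcal D(L)$ be a class of functions (modulo $\mu$-a.e. equality) which is contained and dense in $L^p(\mu)$ for every $1<p<\infty$, contains the constants, is stable under $L$, under $P_t$ for $t>0$, and under composition with $\mathcal C^\infty$ functions (that is, $\Phi(f_1,\dots,f_n)\in\mathcal A$ for $f_i\in\mathcal A$ and $\Phi\in \mathcal C^\infty(\mathbb R^n)$), and is such that $P_tf\to\int f\,d\mu$ in $L^2(\mu)$ as $t\to\infty$ for all $f\in\mathcal A$. For $f,g\in\mathcal A$ put $$\Gamma(f,g)=\tfrac12\big(L(fg)-fLg-gLf\big),\qquad \Gamma_2(f,g)=\tfrac12\big(L\Gamma(f,g)-\Gamma(f,Lg)-\Gamma(g,Lf)\big),$$ $\Gamma(f)=\Gamma(f,f)$, $\Gamma_2(f)=\Gamma_2(f,f)$. Assume that $L$ is a diffusion: for all $n$, all $\Phi\in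 \mathcal C^\infty(\mathbb R^n)$ and $f=(f_1,\dots,f_n)\in\mathcal A^n$, $$L(\Phi(f))=\sum_{i}\partial_i\Phi(f)\,Lf_i+\sum_{i,j}\partial^2_{ij}\Phi(f)\,\Gamma(f_i,f_j).$$ All identities and inequalities between functions are understood $\mu$-a.e. **Theorem.** Assume that for some $\rho>0$ one has $\Gamma_2(f)\ge\rho\,\Gamma(f)$ for all $f\in\mathcal A$. 1. For all $f\in\mathcal A$, all $t>0$ and all $\alpha>\dfrac{e^{2\rho t}+e^{-2\rho t}-2}{2\rho(e^{2\rho t}-1)}$, $$\log P_t(e^f)-P_tf\le c_\alpha(t)\,\log P_t\big(e^{\alpha\Gamma(f)}\big),$$ where, with $a_t=\sqrt{2\rho\alpha(e^{2\rho t}-1)}$, $$c_\alpha(t)=\frac{\sqrt{1-e^{-2\rho t}}}{2\sqrt{2\rho\alpha}}\,\log\left(\frac{(e^{\rho t}a_t-1)(e^{\rho t}a_t+1+a_t^2-e^{-2\rho t})}{(e^{\rho t}a_t+1)(-e^{\rho t}a_t+1+a_t^2-e^{-2\rho t})}\right).$$ If $e^{\rho t}a_t=1$, the quotient, which then has the form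 $0/0$, is replaced by its limit $\dfrac{e^{2\rho t}}{2-e^{2\rho t}}$. 2. For all $\alpha>\frac1{2\rho}$ and all $f\in\mathcal A$ with $\int f\,d\mu=0$, $$\int e^f\,d\mu\le\left(\int e^{\alpha\Gamma(f)}\,d\mu\right)^{\frac{1}{2\sqrt{2\rho\alpha}}\log\frac{\sqrt{2\rho\alpha}+1}{\sqrt{2\rho\alpha}-1}}.$$ 3. For all $\alpha>\frac1{2\rho}$ this exponent is strictly smaller than $\frac{1}{2\rho\alpha-1}$, the Bobkov–Götze exponent $\frac{c}{\alpha-c}$ with $c=\frac1{2\rho}$: $$\frac{1}{2\sqrt{2\rho\alpha}}\log\frac{\sqrt{2\rho\alpha}+1}{\sqrt{2\rho\alpha}-1}<\frac1{2\rho\alpha-1}.$$ -/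

import Mathlib

open MeasureTheory Filter Topology
open scoped ContDiff ENNReal

noncomputable section

/-- A symmetric Markov semigroup `(P_t)_{t ≥ 0}` on `L²(μ)`, `μ` a probability measure: a strongly
continuous semigroup of bounded operators which are symmetric (so that the generator is
self-adjoint), preserve positivity and fix the constant function `1`.
Only the times `t ≥ 0` are meaningful. -/
structure MarkovSemigroup {X : Type*} [MeasurableSpace X] (μ : Measure X)
    [IsProbabilityMeasure μ] where
  P : ℝ → (Lp ℝ 2 μ →L[ℝ] Lp ℝ 2 μ)
  zero : P 0 = ContinuousLinearMap.id ℝ (Lp ℝ 2 μ)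
  add : ∀ s t : ℝ, 0 ≤ s → 0 ≤ t → P (s + t) = (P s).comp (P t)
  continuous_zero : ∀ u : Lp ℝ 2 μ, Tendsto (fun t : ℝ => P t u) (𝓝[>] 0) (𝓝 u)
  symm : ∀ t : ℝ, 0 ≤ t → ∀ u v : Lp ℝ 2 μ, inner ℝ (P t u) v = inner ℝ u (P t v)
  nonneg : ∀ t : ℝ, 0 ≤ t → ∀ u : Lp ℝ 2 μ, 0 ≤ u → 0 ≤ P t u
  one : ∀ t : ℝ, 0 ≤ t → P t (Lp.const 2 μ (1 : ℝ)) = Lp.const 2 μ (1 : ℝ)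

namespace MarkovSemigroup

variable {X : Type*} [MeasurableSpace X] {μ : Measure X} [IsProbabilityMeasure μ]

open Classical in
/-- `P_t f` for a square integrable function `f`, as a function (defined up to `μ`-null sets). -/
def act (S : MarkovSemigroup μ) (t : ℝ) (f : X → ℝ) : X → ℝ :=
  if h : MemLp f 2 μ then S.P t (h.toLp f) else 0

/-- `u` is in the domain of the `L²(μ)`-generator of the semigroup, which maps it to `v`. -/
def HasGenerator (S : MarkovSemigroup μ) (u v : Lp ℝ 2 μ) : Prop :=
  Tendsto (fun t : ℝ => t⁻¹ • (S.P t u - u)) (𝓝[>] 0) (𝓝 v)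

/-- The function `f` belongs to the domain `D(L) ⊆ L²(μ)` of the generator `L`. -/
def MemDomain (S : MarkovSemigroup μ) (f : X → ℝ) : Prop :=
  ∃ h : MemLp f 2 μ, ∃ v : Lp ℝ 2 μ, S.HasGenerator (h.toLp f) v

open Classical in
/-- The generator `L f = lim_{t → 0⁺} (P_t f - f) / t` (limit in `L²(μ)`) for `f ∈ D(L)`,
as a function (defined up to `μ`-null sets). -/
def gen (S : MarkovSemigroup μ) (f : X → ℝ) : X → ℝ :=
  if h : S.MemDomain f then (h.choose_spec.choose : Lp ℝ 2 μ) else 0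

/-- The carré du champ `Γ(f, g) = (L(fg) - f Lg - g Lf) / 2`. -/
def carre (S : MarkovSemigroup μ) (f g : X → ℝ) : X → ℝ := fun x =>
  (1 / 2) * (S.gen (fun y => f y * g y) x - f x * S.gen g x - g x * S.gen f x)

/-- The iterated carré du champ `Γ₂(f, g) = (L Γ(f, g) - Γ(f, Lg) - Γ(g, Lf)) / 2`. -/
def carreTwo (S : MarkovSemigroup μ) (f g : X → ℝ) : X → ℝ := fun x =>
  (1 / 2) * (S.gen (S.carre f g) x - S.carre f (S.gen g) x - S.carre g (S.gen f) x)

/-- `A` is a good family of functions for the semigroup. As usual in `L^p`, functions are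
considered modulo `μ`-a.e. equality, hence `congr`. -/
structure IsGoodFamily (S : MarkovSemigroup μ) (A : Set (X → ℝ)) : Prop where
  congr : ∀ f g : X → ℝ, f ∈ A → f =ᵐ[μ] g → g ∈ A
  memLp : ∀ p : ℝ≥0∞, 1 < p → p < ⊤ → ∀ f ∈ A, MemLp f p μ
  dense : ∀ p : ℝ≥0∞, 1 < p → p < ⊤ → ∀ g : X → ℝ, MemLp g p μ →
    ∀ ε : ℝ≥0∞, 0 < ε → ∃ f ∈ A, eLpNorm (g - f) p μ < ε
  const : ∀ c : ℝ, (fun _ : X => c) ∈ A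
  act_mem : ∀ t : ℝ, 0 < t → ∀ f ∈ A, S.act t f ∈ A
  memDomain : ∀ f ∈ A, S.MemDomain f
  gen_mem : ∀ f ∈ A, S.gen f ∈ A
  comp_mem : ∀ (n : ℕ) (Φ : (Fin n → ℝ) → ℝ), ContDiff ℝ ∞ Φ →
    ∀ f : Fin n → X → ℝ, (∀ i, f i ∈ A) → (fun x => Φ (fun i => f i x)) ∈ A
  ergodic : ∀ f ∈ A,
    Tendsto (fun t : ℝ => eLpNorm (fun x => S.act t f x - ∫ y, f y ∂μ) 2 μ) atTop (𝓝 0)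

end MarkovSemigroup

/-- The partial derivative `∂_i Φ` on `ℝⁿ`. -/
def partialDeriv {n : ℕ} (i : Fin n) (Φ : (Fin n → ℝ) → ℝ) : (Fin n → ℝ) → ℝ := fun x =>
  fderiv ℝ Φ x (Pi.single i 1)

namespace MarkovSemigroup

variable {X : Type*} [MeasurableSpace X] {μ : Measure X} [IsProbabilityMeasure μ]

/-- The diffusion property (change of variables formula) of the generator on `A`. -/
def IsDiffusion (S : MarkovSemigroup μ) (A : Set (X → ℝ)) : Prop :=
  ∀ (n : ℕ) (Φ : (Fin n → ℝ) → ℝ), ContDiff ℝ ∞ Φ →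
    ∀ f : Fin n → X → ℝ, (∀ i, f i ∈ A) →
      ∀ᵐ x ∂μ, S.gen (fun y => Φ (fun k => f k y)) x =
        ∑ i, partialDeriv i Φ (fun k => f k x) * S.gen (f i) x +
        ∑ i, ∑ j, partialDeriv i (partialDeriv j Φ) (fun k => f k x) * S.carre (f i) (f j) x

/-- The curvature condition `Γ₂(f) ≥ ρ Γ(f)` for all `f ∈ A`. -/
def HasCurvature (S : MarkovSemigroup μ) (A : Set (X → ℝ)) (ρ : ℝ) : Prop :=
  ∀ f ∈ A, ∀ᵐ x ∂μ, ρ * S.carre f f x ≤ S.carreTwo f f x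

end MarkovSemigroup

/-- `a_t = √(2ρα(e^{2ρt} - 1))`. -/
def bgA (ρ α t : ℝ) : ℝ := √(2 * ρ * α * (Real.exp (2 * ρ * t) - 1))

/-- The argument of the logarithm in `c_α(t)`. When `e^{ρt} a_t = 1` the quotient reads `0 / 0`;
this is a removable singularity in `α` and the value there is the limit,
`e^{2ρt} / (2 - e^{2ρt})`. -/
def bgRatio (ρ α t : ℝ) : ℝ :=
  if Real.exp (ρ * t) * bgA ρ α t = 1 then
    Real.exp (2 * ρ * t) / (2 - Real.exp (2 * ρ * t))
  else
    ((Real.exp (ρ * t) * bgA ρ α t - 1) *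
        (Real.exp (ρ * t) * bgA ρ α t + 1 + bgA ρ α t ^ 2 - Real.exp (-(2 * ρ * t)))) /
      ((Real.exp (ρ * t) * bgA ρ α t + 1) *
        (-(Real.exp (ρ * t) * bgA ρ α t) + 1 + bgA ρ α t ^ 2 - Real.exp (-(2 * ρ * t))))

/-- The constant `c_α(t)`. -/
def bgConst (ρ α t : ℝ) : ℝ :=
  √(1 - Real.exp (-(2 * ρ * t))) / (2 * √(2 * ρ * α)) * Real.log (bgRatio ρ α t)

/-- The exponent `(1 / (2√(2ρα))) log ((√(2ρα) + 1) / (√(2ρα) - 1))`. -/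
def bgExponent (ρ α : ℝ) : ℝ :=
  1 / (2 * √(2 * ρ * α)) * Real.log ((√(2 * ρ * α) + 1) / (√(2 * ρ * α) - 1))

end

/-!
The inequality is Herbst's argument for the Markov operator `P_t`, based on the local logarithmic
Sobolev inequality and on the variational formula of the entropy. Write `c = (1 - e^{-2ρt}) / (2ρ)`
and `Ent(g) = P_t (g log g) - P_t g log P_t g`.

* *Local logarithmic Sobolev inequality* (`local_logSobolev`): `Ent(e^f) ≤ c P_t (e^f Γ(f))`. With
  `h_s = P_{t-s} e^f` and a nonnegative test function `w`, let `φ(s) = ∫ P_s w · h_s log h_s dμ`. By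
  the diffusion property, with `u = log h_s`, one has `φ' = ∫ P_s w · e^u Γ(u) dμ` and
  `φ'' = 2 ∫ P_s w · e^u Γ₂(u) dμ` (`integral_entropy_first`, `integral_entropy_second`). Hence
  `φ'' ≥ 2ρ φ'`, and this is integrated over `[0, t]`.
* *Entropy inequality* (`act_exp_mul_le`):
  `P_t (α Γ(f) e^{lf}) ≤ Ent(e^{lf}) + P_t e^{lf} log P_t e^{α Γ(f)}`. Together with the previous
  inequality at `l f` it gives
  `(α - c l²) Ent(e^{lf}) ≤ c l² P_t e^{lf} log P_t e^{α Γ(f)}`.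
* *Herbst's argument* (`herbst_scalar`): `Ent(e^{lf}) / P_t e^{lf}` is `l²` times the derivative of
  `l⁻¹ log P_t e^{lf}`, so that `log P_t e^f - P_t f ≤ ∫₀¹ c / (α - c l²) dl · log P_t e^{α Γ(f)}`.
  With `β = √(c / α)` the integral is `(β / 2) log ((1 + β) / (1 - β))`, which is `c_α(t)`
  (`bgConst_eq`).

The second part is the limit `t → ∞` along a sequence of times for which the convergence to the
means holds almost everywhere. The third part is `log y < sinh (log y)`.

No kernel of `P_t` is available, and an almost everywhere statement for each value of a real
parameter cannot be differentiated in that parameter. Two facts circumvent this. Stability under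
composition with all smooth functions forces the functions of a good family to be essentially
bounded (`exists_abs_le`). Therefore the orbits `s ↦ P_s f`, and the curves `l ↦ e^{lf}`, are
differentiable with a second order remainder which is uniform outside null sets
(`HasUniformDeriv`), a notion stable under products, logarithms and `P_t`, and the real variable
arguments are applied to integrals of such curves.
-/

/-! ### Scalar estimates -/

/-- The differential inequality behind the local logarithmic Sobolev inequality:
if `φ'' ≥ 2ρ φ'`, then `φ'(s) ≤ e^{-2ρ(t-s)} φ'(t)`, which is integrated over `[0, t]`. -/
lemma sub_le_of_mul_le_second_deriv {ρ t : ℝ} (hρ : 0 < ρ) (ht : 0 < t) {φ ψ χ : ℝ → ℝ}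
    (hφ : ∀ s ∈ Set.Icc 0 t, HasDerivWithinAt φ (ψ s) (Set.Icc 0 t) s)
    (hψ : ∀ s ∈ Set.Icc 0 t, HasDerivWithinAt ψ (χ s) (Set.Icc 0 t) s)
    (hχ : ∀ s ∈ Set.Icc 0 t, 2 * ρ * ψ s ≤ χ s) :
    φ t - φ 0 ≤ (1 - Real.exp (-(2 * ρ * t))) / (2 * ρ) * ψ t := by
  have h0 : (0 : ℝ) ∈ Set.Icc 0 t := ⟨le_rfl, ht.le⟩
  have h1 : t ∈ Set.Icc 0 t := ⟨ht.le, le_rfl⟩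
  have hsub : interior (Set.Icc 0 t) ⊆ Set.Icc 0 t := interior_subset
  have hE : ∀ s : ℝ, HasDerivAt (fun s => Real.exp (2 * ρ * (t - s)))
      (Real.exp (2 * ρ * (t - s)) * (-(2 * ρ))) s := by
    intro s
    have := (((hasDerivAt_id s).const_sub t).const_mul (2 * ρ)).exp
    simpa using this
  have hE' : ∀ s : ℝ, HasDerivAt (fun s => Real.exp (-(2 * ρ * (t - s))))
      (Real.exp (-(2 * ρ * (t - s))) * (2 * ρ)) s := by
    intro s
    have := (((hasDerivAt_id s).const_sub t).const_mul (2 * ρ)).neg.exp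
    simpa using this
  have hmono : MonotoneOn (fun s => ψ s * Real.exp (2 * ρ * (t - s))) (Set.Icc 0 t) := by
    have hd : ∀ s ∈ Set.Icc 0 t, HasDerivWithinAt (fun s => ψ s * Real.exp (2 * ρ * (t - s)))
        (χ s * Real.exp (2 * ρ * (t - s)) + ψ s * (Real.exp (2 * ρ * (t - s)) * (-(2 * ρ))))
        (Set.Icc 0 t) s := fun s hs => (hψ s hs).mul (hE s).hasDerivWithinAt
    refine monotoneOn_of_hasDerivWithinAt_nonneg (convex_Icc 0 t)
      (fun s hs => (hd s hs).continuousWithinAt) (fun s hs => (hd s (hsub hs)).mono hsub) ?_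
    intro s hs
    have := hχ s (hsub hs)
    have hp := Real.exp_pos (2 * ρ * (t - s))
    nlinarith
  have hle : ∀ s ∈ Set.Icc 0 t, ψ s ≤ ψ t * Real.exp (-(2 * ρ * (t - s))) := by
    intro s hs
    have := hmono hs h1 hs.2
    simp only [sub_self, mul_zero, Real.exp_zero, mul_one] at this
    rw [Real.exp_neg, ← div_eq_mul_inv, le_div_iff₀ (Real.exp_pos _)]
    exact this
  have hanti : AntitoneOn (fun s => φ s - ψ t * Real.exp (-(2 * ρ * (t - s))) / (2 * ρ))
      (Set.Icc 0 t) := by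
    have hd : ∀ s ∈ Set.Icc 0 t, HasDerivWithinAt
        (fun s => φ s - ψ t * Real.exp (-(2 * ρ * (t - s))) / (2 * ρ))
        (ψ s - ψ t * (Real.exp (-(2 * ρ * (t - s))) * (2 * ρ)) / (2 * ρ)) (Set.Icc 0 t) s :=
      fun s hs => (hφ s hs).sub (((hE' s).const_mul (ψ t)).div_const (2 * ρ)).hasDerivWithinAt
    refine antitoneOn_of_hasDerivWithinAt_nonpos (convex_Icc 0 t)
      (fun s hs => (hd s hs).continuousWithinAt) (fun s hs => (hd s (hsub hs)).mono hsub) ?_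
    intro s hs
    have := hle s (hsub hs)
    field_simp
    linarith
  have := hanti h0 h1 ht.le
  simp only [sub_self, mul_zero, neg_zero, Real.exp_zero, sub_zero, mul_one] at this
  have e : (1 - Real.exp (-(2 * ρ * t))) / (2 * ρ) * ψ t
      = ψ t / (2 * ρ) - ψ t * Real.exp (-(2 * ρ * t)) / (2 * ρ) := by ring
  rw [e]; linarith

/-- Herbst's argument in scalar form: the hypothesis bounds `λ² (N(λ)/λ)'`, and `N(λ)/λ` runs from
`N'(0)` at `λ = 0` to `N(1)` at `λ = 1`. The right-hand side is `I ∫₀¹ c / (α - c λ²) dλ`. -/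
lemma herbst_scalar {c α I : ℝ} (hc : 0 < c) (hα : c < α) {N N' : ℝ → ℝ} (hN0 : N 0 = 0)
    (hN : ∀ l ∈ Set.Icc (0 : ℝ) 1, HasDerivWithinAt N (N' l) (Set.Icc 0 1) l)
    (hle : ∀ l ∈ Set.Ioc (0 : ℝ) 1, l * N' l - N l ≤ c * l ^ 2 / (α - c * l ^ 2) * I) :
    N 1 - N' 0 ≤ √(c / α) / 2 * Real.log ((1 + √(c / α)) / (1 - √(c / α))) * I := by
  have hα0 : 0 < α := hc.trans hα
  set β := √(c / α) with hβ
  have hβ2 : β ^ 2 = c / α := Real.sq_sqrt (by positivity)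
  have hβ0 : 0 < β := Real.sqrt_pos.2 (by positivity)
  have hβ1 : β < 1 := by
    have : c / α < 1 := (div_lt_one hα0).2 hα
    nlinarith
  have hdiff : ∀ l ∈ Set.Ioc (0 : ℝ) 1, HasDerivWithinAt
      (fun l => N l / l - β / 2 * (Real.log (1 + β * l) - Real.log (1 - β * l)) * I)
      ((N' l * l - N l * 1) / l ^ 2 -
        β / 2 * ((β * 1) / (1 + β * l) - (-(β * 1)) / (1 - β * l)) * I) (Set.Ioc 0 1) l := by
    intro l hl
    have hbl : β * l < 1 := by nlinarith [hl.1, hl.2]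
    have hbl0 : 0 < β * l := mul_pos hβ0 hl.1
    have d1 := ((hN l ⟨hl.1.le, hl.2⟩).mono Set.Ioc_subset_Icc_self).div
      (hasDerivWithinAt_id l _) hl.1.ne'
    have d2 : HasDerivAt (fun l => Real.log (1 + β * l)) ((β * 1) / (1 + β * l)) l :=
      (((hasDerivAt_id l).const_mul β).const_add 1).log (by simp only [id]; positivity)
    have d3 : HasDerivAt (fun l => Real.log (1 - β * l)) ((-(β * 1)) / (1 - β * l)) l :=
      (((hasDerivAt_id l).const_mul β).const_sub 1).log (by simp only [id]; linarith)
    exact d1.sub ((((d2.sub d3).const_mul (β / 2)).mul_const I).hasDerivWithinAt)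
  have hanti : AntitoneOn
      (fun l => N l / l - β / 2 * (Real.log (1 + β * l) - Real.log (1 - β * l)) * I)
      (Set.Ioc 0 1) := by
    refine antitoneOn_of_hasDerivWithinAt_nonpos (convex_Ioc 0 1)
      (fun s hs => (hdiff s hs).continuousWithinAt)
      (fun s hs => (hdiff s (interior_subset hs)).mono interior_subset) ?_
    intro l hl
    have hl := interior_subset hl
    have hbl : β * l < 1 := by nlinarith [hl.1, hl.2]
    have hbl0 : 0 < β * l := mul_pos hβ0 hl.1
    have hl0 := hl.1
    have hcl : 0 < α - c * l ^ 2 := by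
      have : l ^ 2 ≤ 1 := by nlinarith [hl.1, hl.2]
      nlinarith
    have e : β / 2 * ((β * 1) / (1 + β * l) - (-(β * 1)) / (1 - β * l)) = c / (α - c * l ^ 2) := by
      have h1 : (1 + β * l) ≠ 0 := by positivity
      have h2 : (1 - β * l) ≠ 0 := by linarith
      have e1 : β / 2 * ((β * 1) / (1 + β * l) - (-(β * 1)) / (1 - β * l))
          = β ^ 2 / (1 - β ^ 2 * l ^ 2) := by
        have h3 : 1 - β ^ 2 * l ^ 2 ≠ 0 := by
          have : 1 - β ^ 2 * l ^ 2 = (1 + β * l) * (1 - β * l) := by ring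
          rw [this]; exact mul_ne_zero h1 h2
        field_simp
        ring
      rw [e1, hβ2]
      have h4 : 1 - c / α * l ^ 2 = (α - c * l ^ 2) / α := by field_simp
      rw [h4]
      field_simp
    rw [e, sub_nonpos, div_le_iff₀ (by positivity)]
    have := hle l hl
    calc _ = l * N' l - N l := by ring
      _ ≤ _ := this
      _ = _ := by ring
  have hlim : Tendsto
      (fun l => N l / l - β / 2 * (Real.log (1 + β * l) - Real.log (1 - β * l)) * I)
      (𝓝[>] 0) (𝓝 (N' 0)) := by
    have t1 : Tendsto (fun l => N l / l) (𝓝[>] 0) (𝓝 (N' 0)) := by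
      have := (hN 0 ⟨le_rfl, zero_le_one⟩)
      rw [hasDerivWithinAt_iff_tendsto_slope] at this
      have hs : 𝓝[>] (0 : ℝ) ≤ 𝓝[Set.Icc 0 1 \ {0}] 0 := by
        rw [← nhdsWithin_Ioc_eq_nhdsGT (zero_lt_one' ℝ)]
        exact nhdsWithin_mono _ fun x hx => ⟨⟨hx.1.le, hx.2⟩, hx.1.ne'⟩
      refine (this.mono_left hs).congr fun l => ?_
      simp [slope_def_field, hN0]
    have t2 : ContinuousAt (fun l => β / 2 * (Real.log (1 + β * l) - Real.log (1 - β * l)) * I)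
        0 := by
      have : ContinuousAt Real.log (1 + β * 0) := Real.continuousAt_log (by simp)
      have : ContinuousAt Real.log (1 - β * 0) := Real.continuousAt_log (by simp)
      fun_prop (disch := simp)
    have t3 := t1.sub (t2.tendsto.mono_left nhdsWithin_le_nhds)
    simpa using t3
  have hfin : N 1 / 1 - β / 2 * (Real.log (1 + β * 1) - Real.log (1 - β * 1)) * I ≤ N' 0 := by
    refine ge_of_tendsto hlim ?_
    rw [← nhdsWithin_Ioc_eq_nhdsGT (zero_lt_one' ℝ)]
    filter_upwards [self_mem_nhdsWithin] with l hl
    exact hanti hl ⟨zero_lt_one, le_rfl⟩ hl.2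
  rw [Real.log_div (by positivity) (by linarith)]
  simp only [div_one, mul_one] at hfin
  linarith

/-- With `β = √((1 - e^{-2ρt}) / (2ρα))`, the ratio in `c_α(t)` is `(1 + β) / (1 - β)`: the factors
`e^{ρt} a_t - 1` and `e^{ρt} a_t + 1` cancel. -/
lemma bgConst_eq {ρ t α : ℝ} (hρ : 0 < ρ) (ht : 0 < t)
    (hα : (1 - Real.exp (-(2 * ρ * t))) / (2 * ρ) < α) :
    bgConst ρ α t = √((1 - Real.exp (-(2 * ρ * t))) / (2 * ρ) / α) / 2 *
      Real.log ((1 + √((1 - Real.exp (-(2 * ρ * t))) / (2 * ρ) / α)) /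
        (1 - √((1 - Real.exp (-(2 * ρ * t))) / (2 * ρ) / α))) := by
  set x := Real.exp (ρ * t) with hx
  have hx1 : 1 < x := Real.one_lt_exp_iff.2 (by positivity)
  have hx0 : 0 < x := by linarith
  have e2 : Real.exp (2 * ρ * t) = x ^ 2 := by
    rw [hx, ← Real.exp_nat_mul]; congr 1; push_cast; ring
  have e3 : Real.exp (-(2 * ρ * t)) = (x ^ 2)⁻¹ := by rw [Real.exp_neg, e2]
  set c := (1 - Real.exp (-(2 * ρ * t))) / (2 * ρ) with hc
  have hx2 : 1 < x ^ 2 := by nlinarith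
  have hnum : 0 < 1 - Real.exp (-(2 * ρ * t)) := by
    rw [e3]; have := inv_lt_one_of_one_lt₀ hx2; linarith
  have hc0 : 0 < c := by positivity
  have hα0 : 0 < α := hc0.trans hα
  set β := √(c / α) with hβ
  have hβ2 : β ^ 2 = c / α := Real.sq_sqrt (by positivity)
  have hβ0 : 0 < β := Real.sqrt_pos.2 (by positivity)
  have hβ1 : β < 1 := by
    have : c / α < 1 := (div_lt_one hα0).2 hα
    nlinarith
  set a := bgA ρ α t with ha
  have ha2 : a ^ 2 = 2 * ρ * α * (x ^ 2 - 1) := by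
    rw [ha, bgA, e2]
    exact Real.sq_sqrt (mul_nonneg (by positivity) (by linarith))
  have ha0 : 0 < a := by
    rw [ha, bgA, e2]
    exact Real.sqrt_pos.2 (mul_pos (by positivity) (by linarith))
  have hab : a * β = x - 1 / x := by
    have h1 : (a * β) ^ 2 = (x - 1 / x) ^ 2 := by
      rw [mul_pow, ha2, hβ2, hc, e3]; field_simp
    have h2 : 0 ≤ x - 1 / x := by
      rw [sub_nonneg, div_le_iff₀ hx0]; nlinarith
    exact (sq_eq_sq₀ (by positivity) h2).1 h1
  have hpre : √(1 - Real.exp (-(2 * ρ * t))) / (2 * √(2 * ρ * α)) = β / 2 := by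
    rw [hβ, hc, div_div, Real.sqrt_div hnum.le]
    ring
  have hratio : bgRatio ρ α t = (1 + β) / (1 - β) := by
    have hb : (1 : ℝ) - β ≠ 0 := by linarith
    have key : (1 + β) / (1 - β) = (a + (x - 1 / x)) / (a - (x - 1 / x)) := by
      rw [← hab, show a + a * β = a * (1 + β) by ring, show a - a * β = a * (1 - β) by ring,
        mul_div_mul_left _ _ ha0.ne']
    have hne : a - (x - 1 / x) ≠ 0 := by
      rw [← hab, show a - a * β = a * (1 - β) by ring]; exact mul_ne_zero ha0.ne' hb
    rw [key, bgRatio, ← ha, ← hx, e2, e3]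
    split_ifs with h
    · have ha' : a = 1 / x := by field_simp; linarith
      rw [ha'] at hne ⊢
      have : 2 - x ^ 2 ≠ 0 := by
        intro h0; apply hne; field_simp; linarith
      rw [div_eq_div_iff this hne]
      field_simp
      ring
    · have hxa : x * a - 1 ≠ 0 := sub_ne_zero.2 h
      have hxa' : x * a + 1 ≠ 0 := by positivity
      have f1 : x * a + 1 + a ^ 2 - (x ^ 2)⁻¹ = (x * a + 1) / x * (a + (x - 1 / x)) := by
        field_simp; ring
      have f2 : -(x * a) + 1 + a ^ 2 - (x ^ 2)⁻¹ = (x * a - 1) / x * (a - (x - 1 / x)) := by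
        field_simp; ring
      rw [f1, f2]
      have : (x * a - 1) * ((x * a + 1) / x * (a + (x - 1 / x))) =
        ((x * a - 1) * (x * a + 1) / x) * (a + (x - 1 / x)) := by ring
      rw [this]
      have : (x * a + 1) * ((x * a - 1) / x * (a - (x - 1 / x))) =
        ((x * a - 1) * (x * a + 1) / x) * (a - (x - 1 / x)) := by ring
      rw [this, mul_div_mul_left]
      positivity
  rw [bgConst, hpre, hratio]

lemma bgExponent_eq {ρ α : ℝ} (hρ : 0 < ρ) (hα : 1 / (2 * ρ) < α) :
    bgExponent ρ α = √(1 / (2 * ρ) / α) / 2 *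
      Real.log ((1 + √(1 / (2 * ρ) / α)) / (1 - √(1 / (2 * ρ) / α))) := by
  have hα0 : 0 < α := lt_trans (by positivity) hα
  have hs : 1 < 2 * ρ * α := by
    rw [div_lt_iff₀ (by positivity)] at hα; linarith
  have hs1 : 1 < √(2 * ρ * α) := by rw [Real.lt_sqrt (by norm_num)]; simpa using hs
  have e : √(1 / (2 * ρ) / α) = 1 / √(2 * ρ * α) := by
    rw [div_div, Real.sqrt_div zero_le_one, Real.sqrt_one]
  rw [bgExponent, e]
  set s := √(2 * ρ * α)
  have h1 : s - 1 ≠ 0 := by linarith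
  have e2 : (s + 1) / (s - 1) = (1 + 1 / s) / (1 - 1 / s) := by
    have h2 : 1 - 1 / s ≠ 0 := by
      have : 1 / s < 1 := by rw [div_lt_one (by linarith)]; exact hs1
      linarith
    rw [div_eq_div_iff h1 h2]
    field_simp
  rw [e2]
  ring

lemma tendsto_bgConst_atTop {ρ α : ℝ} (hρ : 0 < ρ) (hα : 1 / (2 * ρ) < α) :
    Tendsto (fun t => bgConst ρ α t) atTop (𝓝 (bgExponent ρ α)) := by
  have hα0 : 0 < α := lt_trans (by positivity) hα
  have hs1 : √(1 / (2 * ρ) / α) < 1 := by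
    rw [Real.sqrt_lt' one_pos, div_lt_iff₀ hα0]; simpa using hα
  have hexp : Tendsto (fun t => Real.exp (-(2 * ρ * t))) atTop (𝓝 0) :=
    Real.tendsto_exp_neg_atTop_nhds_zero.comp (tendsto_id.const_mul_atTop (by positivity))
  have hb : Tendsto (fun t => √((1 - Real.exp (-(2 * ρ * t))) / (2 * ρ) / α)) atTop
      (𝓝 √(1 / (2 * ρ) / α)) := by
    have := (((hexp.const_sub 1).div_const (2 * ρ)).div_const α).sqrt
    simpa using this
  have hne : 1 - √(1 / (2 * ρ) / α) ≠ 0 := by linarith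
  have hnn := Real.sqrt_nonneg (1 / (2 * ρ) / α)
  have := (hb.div_const 2).mul (((hb.const_add 1).div (hb.const_sub 1) hne).log
    (div_ne_zero (by positivity) hne))
  rw [bgExponent_eq hρ hα]
  refine this.congr' ?_
  filter_upwards [eventually_gt_atTop 0] with t ht
  refine (bgConst_eq hρ ht (lt_of_le_of_lt ?_ hα)).symm
  gcongr
  linarith [Real.exp_pos (-(2 * ρ * t))]

/-- With `y = (s + 1) / (s - 1)` and `s = √(2ρα)`, this is `log y < sinh (log y)`. -/
lemma bgExponent_lt {ρ α : ℝ} (hρ : 0 < ρ) (hα : 1 / (2 * ρ) < α) :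
    bgExponent ρ α < 1 / (2 * ρ * α - 1) := by
  have hs : 1 < 2 * ρ * α := by
    rw [div_lt_iff₀ (by positivity)] at hα; linarith
  have hs1 : 1 < √(2 * ρ * α) := by rw [Real.lt_sqrt (by norm_num)]; simpa using hs
  have hsq : √(2 * ρ * α) ^ 2 = 2 * ρ * α := Real.sq_sqrt (by linarith)
  rw [bgExponent, ← hsq, Real.sqrt_sq (by positivity)]
  set s := √(2 * ρ * α)
  have h1 : 0 < s - 1 := by linarith
  have hy : 1 < (s + 1) / (s - 1) := by rw [lt_div_iff₀ h1]; linarith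
  have := Real.self_lt_sinh_iff.2 (Real.log_pos hy)
  rw [Real.sinh_log (by linarith)] at this
  have h2 : s ^ 2 - 1 ≠ 0 := by nlinarith
  calc 1 / (2 * s) * Real.log ((s + 1) / (s - 1))
      < 1 / (2 * s) * (((s + 1) / (s - 1) - ((s + 1) / (s - 1))⁻¹) / 2) := by
        gcongr
    _ = 1 / (s ^ 2 - 1) := by
        have : s ^ 2 - 1 = (s - 1) * (s + 1) := by ring
        rw [this]
        field_simp
        ring

/-! ### Differentiation uniformly outside null sets -/

/-- The curve `a : I → L^∞(μ)` is bounded and has the bounded derivative `a'`, with a remainder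
`O((r - s)²)` in the first order expansion which is uniform over `I` and over almost all points.
The null set may depend on `r` and `s`. -/
structure HasUniformDeriv {X : Type*} [MeasurableSpace X] (μ : Measure X) (I : Set ℝ)
    (a a' : ℝ → X → ℝ) : Prop where
  aesm : ∀ s ∈ I, AEStronglyMeasurable (a s) μ
  aesm' : ∀ s ∈ I, AEStronglyMeasurable (a' s) μ
  bdd : ∃ C, 0 ≤ C ∧ ∀ s ∈ I, ∀ᵐ x ∂μ, |a s x| ≤ C
  bdd' : ∃ C, 0 ≤ C ∧ ∀ s ∈ I, ∀ᵐ x ∂μ, |a' s x| ≤ C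
  expansion : ∃ C, 0 ≤ C ∧ ∀ s ∈ I, ∀ r ∈ I, ∀ᵐ x ∂μ,
    |a r x - a s x - (r - s) * a' s x| ≤ C * (r - s) ^ 2

namespace HasUniformDeriv

variable {X : Type*} [MeasurableSpace X] {μ : Measure X} {I J : Set ℝ} {a a' b b' : ℝ → X → ℝ}

lemma mono (h : HasUniformDeriv μ I a a') (hJ : J ⊆ I) : HasUniformDeriv μ J a a' where
  aesm s hs := h.aesm s (hJ hs)
  aesm' s hs := h.aesm' s (hJ hs)
  bdd := h.bdd.imp fun _ hC => ⟨hC.1, fun s hs => hC.2 s (hJ hs)⟩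
  bdd' := h.bdd'.imp fun _ hC => ⟨hC.1, fun s hs => hC.2 s (hJ hs)⟩
  expansion := h.expansion.imp fun _ hC => ⟨hC.1, fun s hs r hr => hC.2 s (hJ hs) r (hJ hr)⟩

lemma congr {d d' : ℝ → X → ℝ} (h : HasUniformDeriv μ I a a') (e : ∀ s ∈ I, a s =ᵐ[μ] d s)
    (e' : ∀ s ∈ I, a' s =ᵐ[μ] d' s) : HasUniformDeriv μ I d d' where
  aesm s hs := (h.aesm s hs).congr (e s hs)
  aesm' s hs := (h.aesm' s hs).congr (e' s hs)
  bdd := by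
    obtain ⟨C, hC0, hC⟩ := h.bdd
    refine ⟨C, hC0, fun s hs => ?_⟩
    filter_upwards [hC s hs, e s hs] with x h1 h2
    rwa [← h2]
  bdd' := by
    obtain ⟨C, hC0, hC⟩ := h.bdd'
    refine ⟨C, hC0, fun s hs => ?_⟩
    filter_upwards [hC s hs, e' s hs] with x h1 h2
    rwa [← h2]
  expansion := by
    obtain ⟨C, hC0, hC⟩ := h.expansion
    refine ⟨C, hC0, fun s hs r hr => ?_⟩
    filter_upwards [hC s hs r hr, e s hs, e r hr, e' s hs] with x h1 h2 h3 h4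
    rwa [← h2, ← h3, ← h4]

lemma lipschitz (h : HasUniformDeriv μ I a a') :
    ∃ C, 0 ≤ C ∧ ∀ s ∈ I, ∀ r ∈ I, ∀ᵐ x ∂μ, |a r x - a s x| ≤ C * |r - s| := by
  obtain ⟨C, hC0, hC⟩ := h.expansion
  obtain ⟨K, hK0, hK⟩ := h.bdd
  obtain ⟨K', hK0', hK'⟩ := h.bdd'
  refine ⟨2 * K + K' + C, by positivity, fun s hs r hr => ?_⟩
  filter_upwards [hC s hs r hr, hK s hs, hK r hr, hK' s hs] with x h1 h2 h3 h4
  have hd := abs_nonneg (r - s)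
  rcases le_total |r - s| 1 with hle | hle
  · have e : a r x - a s x = (a r x - a s x - (r - s) * a' s x) + (r - s) * a' s x := by ring
    have h5 : |(r - s) * a' s x| ≤ |r - s| * K' := by
      rw [abs_mul]; exact mul_le_mul_of_nonneg_left h4 hd
    have h6 : C * (r - s) ^ 2 ≤ C * |r - s| := by
      rw [← sq_abs]; gcongr; nlinarith
    rw [e]
    refine (abs_add_le _ _).trans ?_
    nlinarith
  · refine (abs_sub _ _).trans ?_
    nlinarith

lemma mul (ha : HasUniformDeriv μ I a a') (hb : HasUniformDeriv μ I b b') :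
    HasUniformDeriv μ I (fun s x => a s x * b s x)
      (fun s x => a' s x * b s x + a s x * b' s x) where
  aesm s hs := (ha.aesm s hs).mul (hb.aesm s hs)
  aesm' s hs := ((ha.aesm' s hs).mul (hb.aesm s hs)).add ((ha.aesm s hs).mul (hb.aesm' s hs))
  bdd := by
    obtain ⟨C, hC0, hC⟩ := ha.bdd
    obtain ⟨D, hD0, hD⟩ := hb.bdd
    refine ⟨C * D, by positivity, fun s hs => ?_⟩
    filter_upwards [hC s hs, hD s hs] with x h1 h2
    rw [abs_mul]; gcongr
  bdd' := by
    obtain ⟨C, hC0, hC⟩ := ha.bdd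
    obtain ⟨D, hD0, hD⟩ := hb.bdd
    obtain ⟨C', hC0', hC'⟩ := ha.bdd'
    obtain ⟨D', hD0', hD'⟩ := hb.bdd'
    refine ⟨C' * D + C * D', by positivity, fun s hs => ?_⟩
    filter_upwards [hC s hs, hD s hs, hC' s hs, hD' s hs] with x h1 h2 h3 h4
    refine (abs_add_le _ _).trans ?_
    rw [abs_mul, abs_mul]; gcongr
  expansion := by
    obtain ⟨C, hC0, hC⟩ := ha.bdd
    obtain ⟨D, hD0, hD⟩ := hb.bdd
    obtain ⟨L, hL0, hL⟩ := ha.lipschitz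
    obtain ⟨M, hM0, hM⟩ := hb.lipschitz
    obtain ⟨E, hE0, hE⟩ := ha.expansion
    obtain ⟨F, hF0, hF⟩ := hb.expansion
    refine ⟨E * D + C * F + L * M, by positivity, fun s hs r hr => ?_⟩
    filter_upwards [hC s hs, hD s hs, hL s hs r hr, hM s hs r hr, hE s hs r hr, hF s hs r hr]
      with x h1 h2 h3 h4 h5 h6
    have e : a r x * b r x - a s x * b s x - (r - s) * (a' s x * b s x + a s x * b' s x)
        = (a r x - a s x - (r - s) * a' s x) * b s x + a s x * (b r x - b s x - (r - s) * b' s x)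
          + (a r x - a s x) * (b r x - b s x) := by ring
    rw [e]
    calc _ ≤ E * (r - s) ^ 2 * D + C * (F * (r - s) ^ 2) + (L * |r - s|) * (M * |r - s|) := by
          refine (abs_add_le _ _).trans (add_le_add ((abs_add_le _ _).trans (add_le_add ?_ ?_)) ?_)
          all_goals rw [abs_mul]; gcongr
      _ = (E * D + C * F + L * M) * (r - s) ^ 2 := by rw [← sq_abs (r - s)]; ring

lemma add (ha : HasUniformDeriv μ I a a') (hb : HasUniformDeriv μ I b b') :
    HasUniformDeriv μ I (fun s x => a s x + b s x) (fun s x => a' s x + b' s x) where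
  aesm s hs := (ha.aesm s hs).add (hb.aesm s hs)
  aesm' s hs := (ha.aesm' s hs).add (hb.aesm' s hs)
  bdd := by
    obtain ⟨C, hC0, hC⟩ := ha.bdd
    obtain ⟨D, hD0, hD⟩ := hb.bdd
    refine ⟨C + D, by positivity, fun s hs => ?_⟩
    filter_upwards [hC s hs, hD s hs] with x h1 h2
    exact (abs_add_le _ _).trans (add_le_add h1 h2)
  bdd' := by
    obtain ⟨C, hC0, hC⟩ := ha.bdd'
    obtain ⟨D, hD0, hD⟩ := hb.bdd'
    refine ⟨C + D, by positivity, fun s hs => ?_⟩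
    filter_upwards [hC s hs, hD s hs] with x h1 h2
    exact (abs_add_le _ _).trans (add_le_add h1 h2)
  expansion := by
    obtain ⟨E, hE0, hE⟩ := ha.expansion
    obtain ⟨F, hF0, hF⟩ := hb.expansion
    refine ⟨E + F, by positivity, fun s hs r hr => ?_⟩
    filter_upwards [hE s hs r hr, hF s hs r hr] with x h5 h6
    have e : a r x + b r x - (a s x + b s x) - (r - s) * (a' s x + b' s x)
        = (a r x - a s x - (r - s) * a' s x) + (b r x - b s x - (r - s) * b' s x) := by ring
    rw [e, add_mul]
    exact (abs_add_le _ _).trans (add_le_add h5 h6)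

/-- A bounded function, seen as a constant curve. -/
lemma of_bdd {k : X → ℝ} (hk : AEStronglyMeasurable k μ) {C : ℝ} (hC : ∀ᵐ x ∂μ, |k x| ≤ C) :
    HasUniformDeriv μ I (fun _ => k) (fun _ _ => 0) where
  aesm _ _ := hk
  aesm' _ _ := aestronglyMeasurable_const
  bdd := ⟨|C|, abs_nonneg C, fun _ _ => hC.mono fun _ h => h.trans (le_abs_self C)⟩
  bdd' := ⟨0, le_rfl, fun _ _ => by simp⟩
  expansion := ⟨0, le_rfl, fun _ _ _ _ => by simp⟩

lemma sub (ha : HasUniformDeriv μ I a a') (hb : HasUniformDeriv μ I b b') :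
    HasUniformDeriv μ I (fun s x => a s x - b s x) (fun s x => a' s x - b' s x) := by
  have h1 : HasUniformDeriv μ I (fun _ _ => (-1 : ℝ)) (fun _ _ => 0) :=
    of_bdd aestronglyMeasurable_const (C := 1) (by simp)
  refine (ha.add (h1.mul hb)).congr (fun s _ => ?_) (fun s _ => ?_) <;>
  exact Eventually.of_forall fun x => by ring

lemma log (ha : HasUniformDeriv μ I a a') {m : ℝ} (hm : 0 < m)
    (h : ∀ s ∈ I, ∀ᵐ x ∂μ, m ≤ a s x) :
    HasUniformDeriv μ I (fun s x => Real.log (a s x)) (fun s x => a' s x / a s x) where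
  aesm s hs := (Real.measurable_log.comp_aemeasurable (ha.aesm s hs).aemeasurable)
    |>.aestronglyMeasurable
  aesm' s hs := ((ha.aesm' s hs).aemeasurable.div (ha.aesm s hs).aemeasurable).aestronglyMeasurable
  bdd := by
    obtain ⟨C, hC0, hC⟩ := ha.bdd
    refine ⟨|Real.log m| + |Real.log C|, by positivity, fun s hs => ?_⟩
    filter_upwards [hC s hs, h s hs] with x h1 h2
    have h3 := Real.log_le_log hm h2
    have h4 := Real.log_le_log (hm.trans_le h2) ((le_abs_self _).trans h1)
    have := neg_abs_le (Real.log m)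
    have := le_abs_self (Real.log C)
    have := abs_nonneg (Real.log m)
    have := abs_nonneg (Real.log C)
    rw [abs_le]
    constructor <;> linarith
  bdd' := by
    obtain ⟨C, hC0, hC⟩ := ha.bdd'
    refine ⟨C / m, by positivity, fun s hs => ?_⟩
    filter_upwards [hC s hs, h s hs] with x h1 h2
    rw [abs_div, abs_of_pos (hm.trans_le h2)]
    gcongr
  expansion := by
    obtain ⟨L, hL0, hL⟩ := ha.lipschitz
    obtain ⟨E, hE0, hE⟩ := ha.expansion
    refine ⟨L ^ 2 / m ^ 2 + E / m, by positivity, fun s hs r hr => ?_⟩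
    filter_upwards [h s hs, h r hr, hL s hs r hr, hE s hs r hr] with x h1 h2 h3 h4
    set p := a s x
    set q := a r x
    have hp : 0 < p := hm.trans_le h1
    have hq : 0 < q := hm.trans_le h2
    -- `(q - p) / q ≤ log q - log p ≤ (q - p) / p`
    have u1 : Real.log q - Real.log p ≤ (q - p) / p := by
      have := Real.log_le_sub_one_of_pos (div_pos hq hp)
      rw [Real.log_div hq.ne' hp.ne'] at this
      calc _ ≤ _ := this
        _ = _ := by field_simp
    have u2 : (q - p) / q ≤ Real.log q - Real.log p := by
      have := Real.log_le_sub_one_of_pos (div_pos hp hq)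
      rw [Real.log_div hp.ne' hq.ne'] at this
      have e : (q - p) / q = -(p / q - 1) := by field_simp; ring
      rw [e]; linarith
    have u3 : (q - p) / p - (q - p) / q ≤ L ^ 2 / m ^ 2 * (r - s) ^ 2 := by
      have e : (q - p) / p - (q - p) / q = (q - p) ^ 2 / (p * q) := by field_simp
      have h5 : (q - p) ^ 2 ≤ L ^ 2 * (r - s) ^ 2 := by
        rw [← sq_abs, ← sq_abs (r - s), ← mul_pow]; gcongr
      have h6 : m ^ 2 ≤ p * q := by rw [sq]; gcongr
      rw [e, div_mul_eq_mul_div]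
      gcongr
    have u4 : |(q - p - (r - s) * a' s x) / p| ≤ E / m * (r - s) ^ 2 := by
      rw [abs_div, abs_of_pos hp, div_mul_eq_mul_div]
      gcongr
    have e : Real.log q - Real.log p - (r - s) * (a' s x / p)
        = (Real.log q - Real.log p - (q - p) / p) + (q - p - (r - s) * a' s x) / p := by
      field_simp; ring
    rw [e, add_mul]
    refine (abs_add_le _ _).trans (add_le_add ?_ u4)
    rw [abs_le]
    constructor <;>
      linarith [mul_nonneg (div_nonneg (sq_nonneg L) (sq_nonneg m)) (sq_nonneg (r - s))]

/-- The curve `s ↦ a_{t-s}`. -/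
lemma comp_const_sub (ha : HasUniformDeriv μ I a a') {t : ℝ} (hJ : ∀ s ∈ J, t - s ∈ I) :
    HasUniformDeriv μ J (fun s => a (t - s)) (fun s x => -a' (t - s) x) where
  aesm s hs := ha.aesm _ (hJ s hs)
  aesm' s hs := (ha.aesm' _ (hJ s hs)).neg
  bdd := ha.bdd.imp fun _ hC => ⟨hC.1, fun s hs => hC.2 _ (hJ s hs)⟩
  bdd' := by
    obtain ⟨C, hC0, hC⟩ := ha.bdd'
    refine ⟨C, hC0, fun s hs => ?_⟩
    simpa using hC _ (hJ s hs)
  expansion := by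
    obtain ⟨C, hC0, hC⟩ := ha.expansion
    refine ⟨C, hC0, fun s hs r hr => ?_⟩
    filter_upwards [hC _ (hJ s hs) _ (hJ r hr)] with x hx
    convert hx using 2 <;> ring

/-- The exponentials `e^{l k}` of a bounded function `k`, as a curve in `l ∈ [0, 1]`. -/
lemma exp_mul {k : X → ℝ} (hk : AEStronglyMeasurable k μ) {C : ℝ} (hC : ∀ᵐ x ∂μ, |k x| ≤ C) :
    HasUniformDeriv μ (Set.Icc 0 1) (fun l x => Real.exp (l * k x))
      (fun l x => k x * Real.exp (l * k x)) := by
  have hb : ∀ l ∈ Set.Icc (0 : ℝ) 1, ∀ᵐ x ∂μ, Real.exp (l * k x) ≤ Real.exp |C| := by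
    intro l hl
    filter_upwards [hC] with x hx
    refine Real.exp_le_exp.2 ((le_abs_self _).trans ?_)
    rw [abs_mul, abs_of_nonneg hl.1]
    nlinarith [hl.2, le_abs_self C, abs_nonneg (k x)]
  have hm : ∀ l : ℝ, AEStronglyMeasurable (fun x => Real.exp (l * k x)) μ := fun l =>
    Real.continuous_exp.comp_aestronglyMeasurable (hk.const_mul l)
  refine ⟨fun l _ => hm l, fun l _ => hk.mul (hm l), ?_, ?_, ?_⟩
  · refine ⟨Real.exp |C|, by positivity, fun l hl => ?_⟩
    filter_upwards [hb l hl] with x hx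
    rwa [abs_of_pos (Real.exp_pos _)]
  · refine ⟨|C| * Real.exp |C|, by positivity, fun l hl => ?_⟩
    filter_upwards [hb l hl, hC] with x hx hx'
    rw [abs_mul, abs_of_pos (Real.exp_pos _)]
    have := hx'.trans (le_abs_self C)
    gcongr
  · refine ⟨C ^ 2 * Real.exp |C|, by positivity, fun s hs r hr => ?_⟩
    filter_upwards [hb s hs, hb r hr, hC] with x h1 h2 h3
    set K := Real.exp |C|
    set p := s * k x
    set q := r * k x
    -- convexity of the exponential at both points
    have c1 : Real.exp p + (q - p) * Real.exp p ≤ Real.exp q := by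
      have := Real.add_one_le_exp (q - p)
      rw [Real.exp_sub, le_div_iff₀ (Real.exp_pos p)] at this
      linarith
    have c2 : Real.exp q + (p - q) * Real.exp q ≤ Real.exp p := by
      have := Real.add_one_le_exp (p - q)
      rw [Real.exp_sub, le_div_iff₀ (Real.exp_pos q)] at this
      linarith
    have hpos1 := Real.exp_pos p
    have hpos2 := Real.exp_pos q
    have hK : (q - p) * (Real.exp q - Real.exp p) ≤ K * (q - p) ^ 2 := by
      rcases le_total p q with h | h
      · nlinarith [mul_le_mul_of_nonneg_right h2 (sq_nonneg (q - p)),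
          mul_le_mul_of_nonneg_left c2 (sub_nonneg.2 h)]
      · nlinarith [mul_le_mul_of_nonneg_right h1 (sq_nonneg (q - p)),
          mul_le_mul_of_nonneg_left c1 (sub_nonneg.2 h)]
    have hqp : (q - p) ^ 2 ≤ C ^ 2 * (r - s) ^ 2 := by
      have : q - p = (r - s) * k x := by simp only [p, q]; ring
      rw [this, mul_pow, mul_comm]
      have : k x ^ 2 ≤ C ^ 2 := by rw [← sq_abs]; gcongr
      gcongr
    have e : Real.exp q - Real.exp p - (r - s) * (k x * Real.exp p)
        = Real.exp q - (Real.exp p + (q - p) * Real.exp p) := by simp only [p, q]; ring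
    rw [e, abs_of_nonneg (by linarith)]
    calc Real.exp q - (Real.exp p + (q - p) * Real.exp p)
        ≤ (q - p) * (Real.exp q - Real.exp p) := by linarith
      _ ≤ K * (C ^ 2 * (r - s) ^ 2) := hK.trans (by gcongr)
      _ = _ := by ring

lemma integrable [IsFiniteMeasure μ] (ha : HasUniformDeriv μ I a a') {s : ℝ} (hs : s ∈ I) :
    Integrable (a s) μ := by
  obtain ⟨C, -, hC⟩ := ha.bdd
  exact Integrable.of_bound (ha.aesm s hs) C (hC s hs)

lemma integrable' [IsFiniteMeasure μ] (ha : HasUniformDeriv μ I a a') {s : ℝ} (hs : s ∈ I) :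
    Integrable (a' s) μ := by
  obtain ⟨C, -, hC⟩ := ha.bdd'
  exact Integrable.of_bound (ha.aesm' s hs) C (hC s hs)

lemma hasDerivWithinAt_integral [IsFiniteMeasure μ] (ha : HasUniformDeriv μ I a a') {s : ℝ}
    (hs : s ∈ I) : HasDerivWithinAt (fun r => ∫ x, a r x ∂μ) (∫ x, a' s x ∂μ) I s := by
  obtain ⟨C, hC0, hC⟩ := ha.expansion
  rw [hasDerivWithinAt_iff_isLittleO]
  have hbig : (fun r => ∫ x, a r x ∂μ - ∫ x, a s x ∂μ - (r - s) • ∫ x, a' s x ∂μ)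
      =O[𝓝[I] s] fun r => (r - s) ^ 2 := by
    refine Asymptotics.IsBigO.of_bound (C * μ.real Set.univ) ?_
    filter_upwards [self_mem_nhdsWithin] with r hr
    have i1 := ha.integrable hr
    have i2 := ha.integrable hs
    have i3 := ha.integrable' hs
    have i4 : Integrable (fun x => a r x - a s x) μ := i1.sub i2
    rw [smul_eq_mul, ← integral_const_mul, ← integral_sub i1 i2,
      ← integral_sub i4 (i3.const_mul _)]
    refine (norm_integral_le_of_norm_le_const (C := C * (r - s) ^ 2) ?_).trans_eq ?_
    · filter_upwards [hC s hs r hr] with x hx using hx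
    · rw [Real.norm_of_nonneg (sq_nonneg _)]; ring
  refine hbig.trans_isLittleO ?_
  have h1 : (fun r : ℝ => r - s) =o[𝓝[I] s] fun _ => (1 : ℝ) := by
    rw [Asymptotics.isLittleO_one_iff]
    have : ContinuousAt (fun r : ℝ => r - s) s := by fun_prop
    have := this.tendsto.mono_left (nhdsWithin_le_nhds (s := I))
    simpa using this
  have := (Asymptotics.isBigO_refl (fun r : ℝ => r - s) (𝓝[I] s)).mul_isLittleO h1
  simpa [sq] using this

lemma restrict (ha : HasUniformDeriv μ I a a') (E : Set X) :
    HasUniformDeriv (μ.restrict E) I a a' where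
  aesm s hs := (ha.aesm s hs).restrict
  aesm' s hs := (ha.aesm' s hs).restrict
  bdd := ha.bdd.imp fun _ hC => ⟨hC.1, fun s hs => ae_restrict_of_ae (hC.2 s hs)⟩
  bdd' := ha.bdd'.imp fun _ hC => ⟨hC.1, fun s hs => ae_restrict_of_ae (hC.2 s hs)⟩
  expansion := ha.expansion.imp fun _ hC =>
    ⟨hC.1, fun s hs r hr => ae_restrict_of_ae (hC.2 s hs r hr)⟩

end HasUniformDeriv

lemma inner_toLp {X : Type*} [MeasurableSpace X] {μ : Measure X} {f g : X → ℝ}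
    (hf : MemLp f 2 μ) (hg : MemLp g 2 μ) :
    inner ℝ (hf.toLp f) (hg.toLp g) = ∫ x, f x * g x ∂μ := by
  rw [L2.inner_def]
  refine integral_congr_ae ?_
  filter_upwards [hf.coeFn_toLp, hg.coeFn_toLp] with x h1 h2
  rw [h1, h2, real_inner_eq_re_inner]
  simp [mul_comm]

lemma norm_toLp_sq {X : Type*} [MeasurableSpace X] {μ : Measure X} {f : X → ℝ}
    (hf : MemLp f 2 μ) : ‖hf.toLp f‖ ^ 2 = ∫ x, f x ^ 2 ∂μ := by
  rw [← real_inner_self_eq_norm_sq, inner_toLp]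
  simp only [sq]

namespace MarkovSemigroup

variable {X : Type*} [MeasurableSpace X] {μ : Measure X} [IsProbabilityMeasure μ]
variable (S : MarkovSemigroup μ) {f g : X → ℝ} {s t : ℝ}

/-! ### The semigroup acting on functions -/

lemma act_of_memLp (hf : MemLp f 2 μ) (t : ℝ) : S.act t f = S.P t (hf.toLp f) := dif_pos hf

lemma act_congr (h : f =ᵐ[μ] g) (t : ℝ) : S.act t f = S.act t g := by
  by_cases hf : MemLp f 2 μ
  · have hg : MemLp g 2 μ := (memLp_congr_ae h).1 hf
    rw [S.act_of_memLp hf, S.act_of_memLp hg, MemLp.toLp_congr hf hg h]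
  · have hg : ¬ MemLp g 2 μ := fun hg => hf ((memLp_congr_ae h).2 hg)
    rw [act, act, dif_neg hf, dif_neg hg]

lemma memLp_act (t : ℝ) (f : X → ℝ) : MemLp (S.act t f) 2 μ := by
  by_cases hf : MemLp f 2 μ
  · rw [S.act_of_memLp hf]; exact Lp.memLp _
  · rw [act, dif_neg hf]; exact MemLp.zero

lemma toLp_act (hf : MemLp f 2 μ) (t : ℝ) :
    (S.memLp_act t f).toLp (S.act t f) = S.P t (hf.toLp f) := by
  rw [← Lp.toLp_coeFn (S.P t (hf.toLp f)) (Lp.memLp _)]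
  exact MemLp.toLp_congr _ _ (by rw [S.act_of_memLp hf])

lemma act_zero (hf : MemLp f 2 μ) : S.act 0 f =ᵐ[μ] f := by
  rw [S.act_of_memLp hf, S.zero]; exact hf.coeFn_toLp

lemma act_add (hf : MemLp f 2 μ) (hg : MemLp g 2 μ) (t : ℝ) :
    S.act t (fun x => f x + g x) =ᵐ[μ] fun x => S.act t f x + S.act t g x := by
  have h : MemLp (fun x => f x + g x) 2 μ := hf.add hg
  have e : h.toLp _ = hf.toLp f + hg.toLp g := (MemLp.toLp_add hf hg)
  rw [S.act_of_memLp h, e, map_add, S.act_of_memLp hf, S.act_of_memLp hg]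
  exact Lp.coeFn_add _ _

lemma act_const_mul (c : ℝ) (hf : MemLp f 2 μ) (t : ℝ) :
    S.act t (fun x => c * f x) =ᵐ[μ] fun x => c * S.act t f x := by
  have h : MemLp (fun x => c * f x) 2 μ := hf.const_mul c
  have e : h.toLp _ = c • hf.toLp f := (MemLp.toLp_const_smul c hf)
  rw [S.act_of_memLp h, e, map_smul, S.act_of_memLp hf]
  exact Lp.coeFn_smul _ _

lemma act_const (c : ℝ) (ht : 0 ≤ t) : S.act t (fun _ => c) =ᵐ[μ] fun _ => c := by
  have h1 : S.act t (fun _ => (1 : ℝ)) =ᵐ[μ] fun _ => (1 : ℝ) := by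
    have e : (memLp_const (μ := μ) (p := 2) (1 : ℝ)).toLp _ = Lp.const 2 μ (1 : ℝ) := rfl
    rw [S.act_of_memLp (memLp_const 1), e, S.one t ht]
    exact Lp.coeFn_const _ _ _
  have h2 := S.act_const_mul c (memLp_const (μ := μ) (p := 2) (1 : ℝ)) t
  simp only [mul_one] at h2
  filter_upwards [h1, h2] with x e1 e2
  rw [e2, e1, mul_one]

lemma act_nonneg (hf : 0 ≤ᵐ[μ] f) (ht : 0 ≤ t) : 0 ≤ᵐ[μ] S.act t f := by
  by_cases h : MemLp f 2 μ
  · rw [S.act_of_memLp h]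
    refine (Lp.coeFn_nonneg _).2 (S.nonneg t ht _ ((Lp.coeFn_nonneg _).1 ?_))
    filter_upwards [hf, h.coeFn_toLp] with x h1 h2
    rwa [h2]
  · rw [act, dif_neg h]

lemma act_sub (hf : MemLp f 2 μ) (hg : MemLp g 2 μ) (t : ℝ) :
    S.act t (fun x => f x - g x) =ᵐ[μ] fun x => S.act t f x - S.act t g x := by
  have h := S.act_add hf (hg.const_mul (-1)) t
  filter_upwards [h, S.act_const_mul (-1) hg t] with x h1 h2
  rw [h2] at h1
  simpa [← sub_eq_add_neg] using h1

lemma act_mono (hf : MemLp f 2 μ) (hg : MemLp g 2 μ) (h : f ≤ᵐ[μ] g) (ht : 0 ≤ t) :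
    S.act t f ≤ᵐ[μ] S.act t g := by
  have h1 : 0 ≤ᵐ[μ] fun x => g x - f x := by
    filter_upwards [h] with x hx using sub_nonneg.2 hx
  filter_upwards [S.act_nonneg h1 ht, S.act_sub hg hf t] with x h2 h3
  rw [h3] at h2
  exact sub_nonneg.1 h2

lemma le_act {c : ℝ} (hf : MemLp f 2 μ) (h : ∀ᵐ x ∂μ, c ≤ f x) (ht : 0 ≤ t) :
    ∀ᵐ x ∂μ, c ≤ S.act t f x := by
  filter_upwards [S.act_mono (memLp_const c) hf h ht, S.act_const c ht] with x h1 h2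
  rwa [h2] at h1

lemma act_le {c : ℝ} (hf : MemLp f 2 μ) (h : ∀ᵐ x ∂μ, f x ≤ c) (ht : 0 ≤ t) :
    ∀ᵐ x ∂μ, S.act t f x ≤ c := by
  filter_upwards [S.act_mono hf (memLp_const c) h ht, S.act_const c ht] with x h1 h2
  rwa [h2] at h1

lemma abs_act_le {c : ℝ} (hf : MemLp f 2 μ) (h : ∀ᵐ x ∂μ, |f x| ≤ c) (ht : 0 ≤ t) :
    ∀ᵐ x ∂μ, |S.act t f x| ≤ c := by
  filter_upwards [S.le_act (c := -c) hf (h.mono fun x hx => (abs_le.1 hx).1) ht,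
    S.act_le hf (h.mono fun x hx => (abs_le.1 hx).2) ht] with x h1 h2
  exact abs_le.2 ⟨h1, h2⟩

lemma integral_act_mul (hf : MemLp f 2 μ) (hg : MemLp g 2 μ) (ht : 0 ≤ t) :
    ∫ x, S.act t f x * g x ∂μ = ∫ x, f x * S.act t g x ∂μ := by
  rw [← inner_toLp (S.memLp_act t f) hg, ← inner_toLp hf (S.memLp_act t g), S.toLp_act hf,
    S.toLp_act hg, S.symm t ht]

lemma integral_act (hf : MemLp f 2 μ) (ht : 0 ≤ t) : ∫ x, S.act t f x ∂μ = ∫ x, f x ∂μ := by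
  have h := S.integral_act_mul hf (memLp_const (1 : ℝ)) ht
  simp only [mul_one] at h
  rw [h]
  refine integral_congr_ae ?_
  filter_upwards [S.act_const 1 ht] with x hx
  rw [hx, mul_one]

/-- Jensen's inequality `(P_t f)² ≤ P_t (f²)`, from `P_t ((f - q)²) ≥ 0` for all rational `q`. -/
lemma act_sq_le (hf : MemLp f 2 μ) (hf2 : MemLp (fun x => f x ^ 2) 2 μ) (ht : 0 ≤ t) :
    ∀ᵐ x ∂μ, S.act t f x ^ 2 ≤ S.act t (fun y => f y ^ 2) x := by
  have h : ∀ q : ℚ, ∀ᵐ x ∂μ,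
      0 ≤ S.act t (fun y => f y ^ 2) x + ((-2 * q) * S.act t f x + (q : ℝ) ^ 2) := by
    intro q
    have m1 : MemLp (fun x => (-2 * q) * f x) 2 μ := hf.const_mul _
    have m2 : MemLp (fun _ : X => (q : ℝ) ^ 2) 2 μ := memLp_const _
    have m3 : MemLp (fun x => (-2 * q) * f x + (q : ℝ) ^ 2) 2 μ := m1.add m2
    have h0 : 0 ≤ᵐ[μ] fun x => f x ^ 2 + ((-2 * q) * f x + (q : ℝ) ^ 2) := by
      refine Eventually.of_forall fun x => ?_
      have : f x ^ 2 + ((-2 * q) * f x + (q : ℝ) ^ 2) = (f x - q) ^ 2 := by ring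
      simp only [Pi.zero_apply, this]
      positivity
    filter_upwards [S.act_nonneg h0 ht, S.act_add hf2 m3 t, S.act_add m1 m2 t,
      S.act_const_mul (-2 * q) hf t, S.act_const ((q : ℝ) ^ 2) ht] with x h1 h2 h3 h4 h5
    rw [h2, h3, h4, h5] at h1
    exact h1
  filter_upwards [ae_all_iff.2 h] with x hx
  have hc : ∀ q : ℝ, 0 ≤ S.act t (fun y => f y ^ 2) x + ((-2 * q) * S.act t f x + q ^ 2) := by
    intro q
    refine Rat.denseRange_cast.induction_on q ?_ hx
    exact isClosed_le continuous_const (by fun_prop)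
  have := hc (S.act t f x)
  nlinarith

lemma integral_act_sq_le (hf : MemLp f 2 μ) (hf2 : MemLp (fun x => f x ^ 2) 2 μ) (ht : 0 ≤ t) :
    ∫ x, S.act t f x ^ 2 ∂μ ≤ ∫ x, f x ^ 2 ∂μ := by
  rw [← S.integral_act hf2 ht]
  exact integral_mono_ae (S.memLp_act t f).integrable_sq
    ((S.memLp_act t _).integrable one_le_two) (S.act_sq_le hf hf2 ht)

/-- `P_t` is a contraction of `L²(μ)`, here on functions with a square integrable square. -/
lemma norm_P_le (hf : MemLp f 2 μ) (hf2 : MemLp (fun x => f x ^ 2) 2 μ) (ht : 0 ≤ t) :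
    ‖S.P t (hf.toLp f)‖ ≤ ‖hf.toLp f‖ := by
  refine le_of_sq_le_sq ?_ (norm_nonneg _)
  rw [← S.toLp_act hf, norm_toLp_sq, norm_toLp_sq]
  exact S.integral_act_sq_le hf hf2 ht

/-! ### The generator -/

lemma gen_ae_eq (hf : MemLp f 2 μ) {v : Lp ℝ 2 μ} (h : S.HasGenerator (hf.toLp f) v) :
    S.gen f =ᵐ[μ] v := by
  have hd : S.MemDomain f := ⟨hf, v, h⟩
  have e : hd.choose_spec.choose = v := tendsto_nhds_unique hd.choose_spec.choose_spec h
  rw [gen, dif_pos hd, e]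

lemma memLp_gen (f : X → ℝ) : MemLp (S.gen f) 2 μ := by
  by_cases h : S.MemDomain f
  · rw [gen, dif_pos h]; exact Lp.memLp _
  · rw [gen, dif_neg h]; exact MemLp.zero

lemma hasGenerator_gen (h : S.MemDomain f) (hf : MemLp f 2 μ) :
    S.HasGenerator (hf.toLp f) ((S.memLp_gen f).toLp (S.gen f)) := by
  obtain ⟨hf', v, hv⟩ := h
  have e : (S.memLp_gen f).toLp (S.gen f) = v := by
    rw [← Lp.toLp_coeFn v (Lp.memLp v)]
    exact MemLp.toLp_congr _ _ (S.gen_ae_eq hf' hv)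
  rw [e]
  exact hv

lemma gen_congr (h : f =ᵐ[μ] g) (hf : S.MemDomain f) : S.gen f =ᵐ[μ] S.gen g := by
  obtain ⟨hf2, -⟩ := id hf
  have hg2 : MemLp g 2 μ := (memLp_congr_ae h).1 hf2
  have h1 := S.hasGenerator_gen hf hf2
  rw [MemLp.toLp_congr hf2 hg2 h] at h1
  exact ((S.gen_ae_eq hg2 h1).trans (MemLp.coeFn_toLp _)).symm

lemma gen_add (hf : S.MemDomain f) (hg : S.MemDomain g) :
    S.gen (fun x => f x + g x) =ᵐ[μ] fun x => S.gen f x + S.gen g x := by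
  obtain ⟨hf2, -⟩ := id hf
  obtain ⟨hg2, -⟩ := id hg
  have h : MemLp (fun x => f x + g x) 2 μ := hf2.add hg2
  have e : h.toLp _ = hf2.toLp f + hg2.toLp g := (MemLp.toLp_add hf2 hg2)
  have hl : S.HasGenerator (h.toLp _)
      ((S.memLp_gen f).toLp (S.gen f) + (S.memLp_gen g).toLp (S.gen g)) := by
    rw [e]
    refine ((S.hasGenerator_gen hf hf2).add (S.hasGenerator_gen hg hg2)).congr fun t => ?_
    rw [← smul_add, map_add]
    congr 1
    abel
  filter_upwards [S.gen_ae_eq h hl, Lp.coeFn_add ((S.memLp_gen f).toLp (S.gen f))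
    ((S.memLp_gen g).toLp (S.gen g)), (S.memLp_gen f).coeFn_toLp, (S.memLp_gen g).coeFn_toLp]
    with x h1 h2 h3 h4
  rw [h1, h2, Pi.add_apply, h3, h4]

lemma gen_const_mul (c : ℝ) (hf : S.MemDomain f) :
    S.gen (fun x => c * f x) =ᵐ[μ] fun x => c * S.gen f x := by
  obtain ⟨hf2, -⟩ := id hf
  have h : MemLp (fun x => c * f x) 2 μ := hf2.const_mul c
  have e : h.toLp _ = c • hf2.toLp f := (MemLp.toLp_const_smul c hf2)
  have hl : S.HasGenerator (h.toLp _) (c • (S.memLp_gen f).toLp (S.gen f)) := by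
    rw [e]
    refine ((S.hasGenerator_gen hf hf2).const_smul c).congr fun t => ?_
    rw [map_smul, smul_comm, smul_sub c]
  filter_upwards [S.gen_ae_eq h hl, Lp.coeFn_smul c ((S.memLp_gen f).toLp (S.gen f)),
    (S.memLp_gen f).coeFn_toLp] with x h1 h2 h3
  rw [h1, h2, Pi.smul_apply, h3, smul_eq_mul]

lemma integral_gen_mul (hf : S.MemDomain f) (hg : S.MemDomain g) :
    ∫ x, S.gen f x * g x ∂μ = ∫ x, f x * S.gen g x ∂μ := by
  obtain ⟨hf2, -⟩ := id hf
  obtain ⟨hg2, -⟩ := id hg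
  rw [← inner_toLp (S.memLp_gen f) hg2, ← inner_toLp hf2 (S.memLp_gen g)]
  have h1 : Tendsto (fun t : ℝ => inner ℝ (t⁻¹ • (S.P t (hf2.toLp f) - hf2.toLp f)) (hg2.toLp g))
      (𝓝[>] 0) (𝓝 (inner ℝ ((S.memLp_gen f).toLp (S.gen f)) (hg2.toLp g))) :=
    Tendsto.inner (S.hasGenerator_gen hf hf2) tendsto_const_nhds
  have h2 : Tendsto (fun t : ℝ => inner ℝ (hf2.toLp f) (t⁻¹ • (S.P t (hg2.toLp g) - hg2.toLp g)))
      (𝓝[>] 0) (𝓝 (inner ℝ (hf2.toLp f) ((S.memLp_gen g).toLp (S.gen g)))) :=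
    Tendsto.inner tendsto_const_nhds (S.hasGenerator_gen hg hg2)
  refine tendsto_nhds_unique h1 (h2.congr' ?_)
  filter_upwards [self_mem_nhdsWithin] with t ht
  rw [real_inner_smul_left, real_inner_smul_right, inner_sub_left, inner_sub_right,
    S.symm t (le_of_lt ht)]

/-- `P_s` maps difference quotients at time `0` to difference quotients at time `s`. -/
lemma hasDerivWithinAt_P (hf : S.MemDomain f) (hf2 : MemLp f 2 μ) (hs : 0 ≤ s) :
    HasDerivWithinAt (fun r => S.P r (hf2.toLp f)) (S.P s ((S.memLp_gen f).toLp (S.gen f)))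
      (Set.Ici s) s := by
  rw [← hasDerivWithinAt_Ioi_iff_Ici, hasDerivWithinAt_iff_tendsto_slope' (by simp)]
  have h1 := ((S.P s).continuous.tendsto _).comp (S.hasGenerator_gen hf hf2)
  have h2 : Tendsto (fun r : ℝ => r - s) (𝓝[>] s) (𝓝[>] 0) := by
    refine tendsto_nhdsWithin_iff.2 ⟨?_, ?_⟩
    · have : ContinuousAt (fun r : ℝ => r - s) s := by fun_prop
      simpa using this.tendsto.mono_left (nhdsWithin_le_nhds (s := Set.Ioi s))
    · filter_upwards [self_mem_nhdsWithin] with r hr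
      exact sub_pos.2 (Set.mem_Ioi.1 hr)
  refine (h1.comp h2).congr' ?_
  filter_upwards [self_mem_nhdsWithin] with r hr
  have hr : s < r := hr
  have e : S.P r = (S.P s).comp (S.P (r - s)) := by
    rw [← S.add s (r - s) hs (sub_nonneg.2 hr.le)]; congr 1; ring
  rw [slope_def_module, e]
  simp

lemma gen_act (hf : S.MemDomain f) (ht : 0 ≤ t) :
    S.gen (S.act t f) =ᵐ[μ] S.act t (S.gen f) := by
  obtain ⟨hf2, -⟩ := id hf
  have h : S.HasGenerator ((S.memLp_act t f).toLp (S.act t f))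
      (S.P t ((S.memLp_gen f).toLp (S.gen f))) := by
    have h1 := ((S.P t).continuous.tendsto _).comp (S.hasGenerator_gen hf hf2)
    refine h1.congr' ?_
    filter_upwards [self_mem_nhdsWithin] with r hr
    have hr : 0 < r := hr
    have e : S.P r (S.P t (hf2.toLp f)) = S.P t (S.P r (hf2.toLp f)) := by
      rw [← ContinuousLinearMap.comp_apply, ← ContinuousLinearMap.comp_apply,
        ← S.add r t hr.le ht, ← S.add t r ht hr.le, add_comm]
    rw [S.toLp_act hf2, e]
    simp
  rw [S.act_of_memLp (S.memLp_gen f)]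
  exact S.gen_ae_eq _ h

end MarkovSemigroup

/-! ### Auxiliary facts on smooth functions and on set integrals -/

lemma exists_contDiff_forall_floor_abs_le (F : ℕ → ℝ) (hF : Monotone F) :
    ∃ Φ : ℝ → ℝ, ContDiff ℝ ∞ Φ ∧ ∀ x, F ⌊|x|⌋₊ ≤ Φ x := by
  obtain ⟨g, hg⟩ := exists_contMDiffMap_forall_mem_convex_of_local_const (n := ⊤)
    (modelWithCornersSelf ℝ ℝ) (t := fun x : ℝ => Set.Ici (F ⌊|x|⌋₊)) (fun x => convex_Ici _)
    (fun x => by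
      refine ⟨F (⌊|x|⌋₊ + 1), ?_⟩
      have : ∀ᶠ y in 𝓝 x, |y| < |x| + 1 :=
        (continuous_abs.tendsto x).eventually (gt_mem_nhds (by linarith))
      filter_upwards [this] with y hy
      refine hF ?_
      rw [← Nat.floor_add_one (abs_nonneg x)]
      exact Nat.floor_le_floor hy.le)
  exact ⟨g, g.contMDiff.contDiff, hg⟩

/-- A smooth function on the line which is a logarithm on `[ε, ∞)`. -/
lemma exists_contDiff_exp_eq {ε : ℝ} (hε : 0 < ε) :
    ∃ ψ : ℝ → ℝ, ContDiff ℝ ∞ ψ ∧ ∀ x, ε ≤ x → Real.exp (ψ x) = x := by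
  refine ⟨fun x => Real.smoothTransition (2 * x / ε - 1) * Real.log x, ?_, ?_⟩
  · rw [contDiff_iff_contDiffAt]
    intro x
    have hs : ContDiff ℝ ∞ fun x : ℝ => Real.smoothTransition (2 * x / ε - 1) :=
      Real.smoothTransition.contDiff.comp (by fun_prop)
    by_cases hx : x < ε / 2
    · have : (fun x => Real.smoothTransition (2 * x / ε - 1) * Real.log x) =ᶠ[𝓝 x] fun _ => 0 := by
        filter_upwards [gt_mem_nhds hx] with y hy
        rw [Real.smoothTransition.zero_of_nonpos, zero_mul]
        rw [sub_nonpos, div_le_one hε]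
        linarith
      exact contDiffAt_const.congr_of_eventuallyEq this
    · refine hs.contDiffAt.mul (Real.contDiffAt_log.2 ?_)
      have : 0 < ε / 2 := by positivity
      intro h0
      exact hx (h0 ▸ this)
  · intro x hx
    have hx0 : 0 < x := hε.trans_le hx
    have : 1 ≤ 2 * x / ε - 1 := by
      have : 2 ≤ 2 * x / ε := by rw [le_div_iff₀ hε]; linarith
      linarith
    simp only [Real.smoothTransition.one_of_one_le this, one_mul, Real.exp_log hx0]

lemma ae_abs_le_of_forall_abs_setIntegral_le {X : Type*} [MeasurableSpace X] {μ : Measure X}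
    [IsFiniteMeasure μ] {f : X → ℝ} (hf : Integrable f μ) {C : ℝ}
    (h : ∀ E, MeasurableSet E → |∫ x in E, f x ∂μ| ≤ C * μ.real E) : ∀ᵐ x ∂μ, |f x| ≤ C := by
  have h1 : f ≤ᵐ[μ] fun _ => C := ae_le_of_forall_setIntegral_le hf (integrable_const C)
    fun E hE _ => by
      rw [setIntegral_const, smul_eq_mul, mul_comm]
      exact (le_abs_self _).trans (h E hE)
  have h2 : (fun _ => -C) ≤ᵐ[μ] f := ae_le_of_forall_setIntegral_le (integrable_const _) hf
    fun E hE _ => by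
      rw [setIntegral_const, smul_eq_mul]
      have := (abs_le.1 (h E hE)).1
      linarith
  filter_upwards [h1, h2] with x h3 h4
  exact abs_le.2 ⟨h4, h3⟩

namespace MarkovSemigroup

namespace IsGoodFamily

variable {X : Type*} [MeasurableSpace X] {μ : Measure X} [IsProbabilityMeasure μ]
variable {S : MarkovSemigroup μ} {A : Set (X → ℝ)} {f g h u v w : X → ℝ} {s t : ℝ}

/-! ### The algebra of functions -/

lemma memLp_two (hA : S.IsGoodFamily A) (hf : f ∈ A) : MemLp f 2 μ :=
  hA.memLp 2 (by norm_num) (by norm_num) f hf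

lemma integrable (hA : S.IsGoodFamily A) (hf : f ∈ A) : Integrable f μ :=
  (hA.memLp_two hf).integrable one_le_two

lemma aesm (hA : S.IsGoodFamily A) (hf : f ∈ A) : AEStronglyMeasurable f μ :=
  (hA.memLp_two hf).aestronglyMeasurable

lemma comp_mem_one (hA : S.IsGoodFamily A) {ψ : ℝ → ℝ} (hψ : ContDiff ℝ ∞ ψ) (hf : f ∈ A) :
    (fun x => ψ (f x)) ∈ A :=
  hA.comp_mem 1 (fun x => ψ (x 0)) (hψ.comp (by fun_prop)) (fun _ => f) fun _ => hf

lemma add_mem (hA : S.IsGoodFamily A) (hf : f ∈ A) (hg : g ∈ A) : (fun x => f x + g x) ∈ A :=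
  hA.comp_mem 2 (fun x => x 0 + x 1) (by fun_prop) ![f, g] (by simp [Fin.forall_fin_two, hf, hg])

lemma mul_mem (hA : S.IsGoodFamily A) (hf : f ∈ A) (hg : g ∈ A) : (fun x => f x * g x) ∈ A :=
  hA.comp_mem 2 (fun x => x 0 * x 1) (by fun_prop) ![f, g] (by simp [Fin.forall_fin_two, hf, hg])

lemma sub_mem (hA : S.IsGoodFamily A) (hf : f ∈ A) (hg : g ∈ A) : (fun x => f x - g x) ∈ A :=
  hA.comp_mem 2 (fun x => x 0 - x 1) (by fun_prop) ![f, g] (by simp [Fin.forall_fin_two, hf, hg])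

lemma const_mul_mem (hA : S.IsGoodFamily A) (c : ℝ) (hf : f ∈ A) : (fun x => c * f x) ∈ A :=
  hA.comp_mem_one (ψ := fun x => c * x) (by fun_prop) hf

lemma exp_mem (hA : S.IsGoodFamily A) (hf : f ∈ A) : (fun x => Real.exp (f x)) ∈ A :=
  hA.comp_mem_one Real.contDiff_exp hf

lemma carre_mem (hA : S.IsGoodFamily A) (hf : f ∈ A) (hg : g ∈ A) : S.carre f g ∈ A :=
  hA.const_mul_mem (1 / 2) (hA.sub_mem (hA.sub_mem (hA.gen_mem _ (hA.mul_mem hf hg))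
    (hA.mul_mem hf (hA.gen_mem _ hg))) (hA.mul_mem hg (hA.gen_mem _ hf)))

lemma act_mem_of_nonneg (hA : S.IsGoodFamily A) (hf : f ∈ A) (ht : 0 ≤ t) : S.act t f ∈ A := by
  rcases ht.eq_or_lt with rfl | ht
  · exact hA.congr f _ hf (S.act_zero (hA.memLp_two hf)).symm
  · exact hA.act_mem t ht f hf

/-- The functions of a good family are essentially bounded: if `μ(|f| > n) > 0` for all `n`, then
`Φ(f)` is not integrable for a smooth `Φ` with `Φ(x) ≥ n / μ(|f| > n)` on `n ≤ |x| < n + 1`. -/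
lemma exists_abs_le (hA : S.IsGoodFamily A) (hf : f ∈ A) :
    ∃ C, 0 ≤ C ∧ ∀ᵐ x ∂μ, |f x| ≤ C := by
  by_contra! hcon
  let p : ℕ → ℝ := fun n => μ.real {x | (n : ℝ) < |f x|}
  have hp : ∀ n, 0 < p n := by
    intro n
    refine ENNReal.toReal_pos ?_ (measure_ne_top _ _)
    intro h0
    refine hcon n (Nat.cast_nonneg n) ?_
    rw [ae_iff]
    simpa using h0
  have hp_anti : Antitone p := fun m n hmn =>
    measureReal_mono fun x (hx : (n : ℝ) < |f x|) => (Nat.cast_le.2 hmn).trans_lt hx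
  have hF : Monotone fun n : ℕ => (n : ℝ) / p n := fun m n hmn =>
    div_le_div₀ (Nat.cast_nonneg n) (Nat.cast_le.2 hmn) (hp n) (hp_anti hmn)
  obtain ⟨Φ, hΦ, hle⟩ := exists_contDiff_forall_floor_abs_le _ hF
  have hnn : ∀ x, 0 ≤ Φ x := fun x => (div_nonneg (Nat.cast_nonneg _) (hp _).le).trans (hle x)
  obtain ⟨n, hn⟩ := exists_nat_gt (∫ x, Φ (f x) ∂μ)
  have h1 := mul_meas_ge_le_integral_of_nonneg (Eventually.of_forall fun x => hnn (f x))
    (hA.integrable (hA.comp_mem_one hΦ hf)) ((n : ℝ) / p n)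
  have h2 : p n ≤ μ.real {x | (n : ℝ) / p n ≤ Φ (f x)} := by
    refine measureReal_mono fun x (hx : (n : ℝ) < |f x|) => ?_
    exact (hF (Nat.le_floor hx.le)).trans (hle (f x))
  have h3 : (n : ℝ) / p n * p n ≤ (n : ℝ) / p n * μ.real {x | (n : ℝ) / p n ≤ Φ (f x)} :=
    mul_le_mul_of_nonneg_left h2 (div_nonneg (Nat.cast_nonneg _) (hp n).le)
  rw [div_mul_cancel₀ _ (hp n).ne'] at h3
  linarith

lemma exists_exp_eq (hA : S.IsGoodFamily A) (hh : h ∈ A) {ε : ℝ} (hε : 0 < ε)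
    (hle : ∀ᵐ x ∂μ, ε ≤ h x) : ∃ u ∈ A, ∀ᵐ x ∂μ, h x = Real.exp (u x) := by
  obtain ⟨ψ, hψ, he⟩ := exists_contDiff_exp_eq hε
  exact ⟨_, hA.comp_mem_one hψ hh, hle.mono fun x hx => (he _ hx).symm⟩

/-! ### Regularity of the orbits -/

lemma hasDerivWithinAt_setIntegral_act (hA : S.IsGoodFamily A) (hf : f ∈ A) {E : Set X}
    (hE : MeasurableSet E) (hs : 0 ≤ s) :
    HasDerivWithinAt (fun r => ∫ x in E, S.act r f x ∂μ) (∫ x in E, S.act s (S.gen f) x ∂μ)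
      (Set.Ici s) s := by
  have hf2 := hA.memLp_two hf
  have hg : MemLp (E.indicator fun _ => (1 : ℝ)) 2 μ := (memLp_const 1).indicator hE
  have hin : ∀ (r : ℝ) {k : X → ℝ} (hk : MemLp k 2 μ),
      inner ℝ (S.P r (hk.toLp k)) (hg.toLp _) = ∫ x in E, S.act r k x ∂μ := by
    intro r k hk
    rw [← S.toLp_act hk, inner_toLp, ← integral_indicator hE]
    congr 1
    ext x
    by_cases hx : x ∈ E <;> simp [hx]
  have h1 := (S.hasDerivWithinAt_P (hA.memDomain f hf) hf2 hs).inner ℝ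
    (hasDerivWithinAt_const s (Set.Ici s) (hg.toLp _))
  simp only [hin, inner_zero_right, zero_add] at h1
  exact h1

lemma continuousOn_P (hA : S.IsGoodFamily A) (hf : f ∈ A) :
    ContinuousOn (fun r => S.P r ((hA.memLp_two hf).toLp f)) (Set.Ici 0) := by
  set F := (hA.memLp_two hf).toLp f with hF
  have hmain : ∀ r s : ℝ, 0 ≤ s → s ≤ r → ‖S.P r F - S.P s F‖ ≤ ‖S.P (r - s) F - F‖ := by
    intro r s hs hsr
    have hd : 0 ≤ r - s := sub_nonneg.2 hsr
    have e : S.P r = (S.P s).comp (S.P (r - s)) := by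
      rw [← S.add s (r - s) hs hd]; congr 1; ring
    have hv := hA.sub_mem (hA.act_mem_of_nonneg hf hd) hf
    have e2 : (hA.memLp_two hv).toLp _ = S.P (r - s) F - F := by
      rw [hF, ← S.toLp_act]; rfl
    have h2 : MemLp (fun x => (S.act (r - s) f x - f x) ^ 2) 2 μ := by
      simp only [sq]
      exact hA.memLp_two (hA.mul_mem hv hv)
    have := S.norm_P_le (hA.memLp_two hv) h2 hs
    rw [e2, map_sub] at this
    rwa [e]
  have h0 : Tendsto (fun r => ‖S.P r F - F‖) (𝓝[≥] 0) (𝓝 0) := by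
    have h1 : ContinuousWithinAt (fun r => S.P r F) (Set.Ioi 0) 0 := by
      have := S.continuous_zero F
      rwa [ContinuousWithinAt, S.zero]
    have h2 := ((continuousWithinAt_Ioi_iff_Ici.1 h1).sub
      (continuousWithinAt_const (b := F))).norm
    have h3 : ‖S.P 0 F - F‖ = 0 := by rw [S.zero]; simp
    have h4 : Tendsto (fun r => ‖S.P r F - F‖) (𝓝[≥] 0) (𝓝 ‖S.P 0 F - F‖) := h2
    rwa [h3] at h4
  intro s hs
  have hs : 0 ≤ s := hs
  rw [ContinuousWithinAt, tendsto_iff_norm_sub_tendsto_zero]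
  have habs : Tendsto (fun r : ℝ => |r - s|) (𝓝[Set.Ici 0] s) (𝓝[≥] 0) := by
    refine tendsto_nhdsWithin_iff.2 ⟨?_, Eventually.of_forall fun r => Set.mem_Ici.2 (abs_nonneg _)⟩
    have : ContinuousAt (fun r : ℝ => |r - s|) s := by fun_prop
    simpa using this.tendsto.mono_left (nhdsWithin_le_nhds (s := Set.Ici 0))
  refine squeeze_zero' (Eventually.of_forall fun r => norm_nonneg _) ?_ (h0.comp habs)
  filter_upwards [self_mem_nhdsWithin] with r hr
  have hr : 0 ≤ r := hr
  simp only [Function.comp_apply]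
  rcases le_total s r with hsr | hsr
  · rw [abs_of_nonneg (sub_nonneg.2 hsr)]
    exact hmain r s hs hsr
  · rw [abs_of_nonpos (sub_nonpos.2 hsr), neg_sub, norm_sub_rev]
    exact hmain s r hr hsr

lemma continuousOn_setIntegral_act (hA : S.IsGoodFamily A) (hf : f ∈ A) {E : Set X}
    (hE : MeasurableSet E) : ContinuousOn (fun r => ∫ x in E, S.act r f x ∂μ) (Set.Ici 0) := by
  have hg : MemLp (E.indicator fun _ => (1 : ℝ)) 2 μ := (memLp_const 1).indicator hE
  have h1 := (hA.continuousOn_P hf).inner (𝕜 := ℝ) (continuousOn_const (c := hg.toLp _))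
  refine h1.congr fun r _ => ?_
  simp only
  rw [← S.toLp_act, inner_toLp, ← integral_indicator hE]
  congr 1
  ext x
  by_cases hx : x ∈ E <;> simp [hx]

/-- If `|L f| ≤ M`, then `r ↦ ∫_E P_r f` has the Lipschitz constant `M μ(E)`. -/
lemma abs_setIntegral_act_sub_le (hA : S.IsGoodFamily A) (hf : f ∈ A) {M : ℝ}
    (hM : ∀ᵐ x ∂μ, |S.gen f x| ≤ M) {E : Set X} (hE : MeasurableSet E) (hs : 0 ≤ s)
    {r : ℝ} (hr : s ≤ r) :
    |∫ x in E, S.act r f x ∂μ - ∫ x in E, S.act s f x ∂μ| ≤ M * μ.real E * (r - s) := by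
  refine norm_image_sub_le_of_norm_deriv_right_le_segment (a := s) (b := r)
    ((hA.continuousOn_setIntegral_act hf hE).mono fun x hx => hs.trans hx.1)
    (fun x hx => hA.hasDerivWithinAt_setIntegral_act hf hE (hs.trans hx.1))
    (fun x hx => ?_) r ⟨hr, le_rfl⟩
  refine norm_setIntegral_le_of_norm_le_const_ae (measure_lt_top _ _) ?_
  exact ae_restrict_of_ae (S.abs_act_le (S.memLp_gen f) hM (hs.trans hx.1))

/-- The orbit `r ↦ P_r f` is differentiable in `L^∞(μ)`, with derivative `P_r L f` and with a
second order remainder controlled by the supremum of `|L² f|`. The bound is proved for the integral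
over every measurable set. -/
lemma hasUniformDeriv_act (hA : S.IsGoodFamily A) (hf : f ∈ A) :
    HasUniformDeriv μ (Set.Ici 0) (fun r => S.act r f) (fun r => S.act r (S.gen f)) := by
  have hLf := hA.gen_mem f hf
  obtain ⟨K, hK0, hK⟩ := hA.exists_abs_le hf
  obtain ⟨K', hK0', hK'⟩ := hA.exists_abs_le hLf
  obtain ⟨M, hM0, hM⟩ := hA.exists_abs_le (hA.gen_mem _ hLf)
  refine ⟨fun r _ => (S.memLp_act r f).aestronglyMeasurable,
    fun r _ => (S.memLp_act r _).aestronglyMeasurable,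
    ⟨K, hK0, fun r hr => S.abs_act_le (hA.memLp_two hf) hK hr⟩,
    ⟨K', hK0', fun r hr => S.abs_act_le (hA.memLp_two hLf) hK' hr⟩,
    2 * M, by positivity, ?_⟩
  intro s hs r hr
  have hs : 0 ≤ s := hs
  have hr : 0 ≤ r := hr
  have hi : ∀ (r : ℝ) (k : X → ℝ), Integrable (S.act r k) μ := fun r k =>
    (S.memLp_act r k).integrable one_le_two
  refine ae_abs_le_of_forall_abs_setIntegral_le
    (((hi r f).sub (hi s f)).sub ((hi s (S.gen f)).const_mul (r - s))) fun E hE => ?_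
  have i1 : IntegrableOn (fun x => S.act r f x - S.act s f x) E μ :=
    ((hi r f).sub (hi s f)).integrableOn
  change |∫ x in E, (S.act r f x - S.act s f x) - (r - s) * S.act s (S.gen f) x ∂μ| ≤ _
  rw [integral_sub i1 ((hi s (S.gen f)).const_mul (r - s)).integrableOn,
    integral_sub (hi r f).integrableOn (hi s f).integrableOn, integral_const_mul]
  set k : ℝ → ℝ := fun r => ∫ x in E, S.act r f x ∂μ with hk
  set k' : ℝ → ℝ := fun r => ∫ x in E, S.act r (S.gen f) x ∂μ with hk'
  change |k r - k s - (r - s) * k' s| ≤ _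
  have hE0 : 0 ≤ M * μ.real E := by positivity
  -- one-sided expansion: the remainder `k x - k s - (x - s) k' s` has derivative `k' x - k' s`
  have hmain : ∀ s r : ℝ, 0 ≤ s → s ≤ r →
      |k r - k s - (r - s) * k' s| ≤ M * μ.real E * (r - s) * (r - s) := by
    intro s r hs hr
    have hd : ∀ x ∈ Set.Ico s r, HasDerivWithinAt (fun y => k y - (y - s) * k' s)
        (k' x - 1 * k' s) (Set.Ici x) x := fun x hx =>
      (hA.hasDerivWithinAt_setIntegral_act hf hE (hs.trans hx.1)).sub
        (((hasDerivWithinAt_id x _).sub_const s).mul_const (k' s))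
    have hc : ContinuousOn (fun y => k y - (y - s) * k' s) (Set.Icc s r) :=
      ((hA.continuousOn_setIntegral_act hf hE).mono fun x hx => hs.trans hx.1).sub
        (by fun_prop)
    have := norm_image_sub_le_of_norm_deriv_right_le_segment (a := s) (b := r)
      (C := M * μ.real E * (r - s)) hc hd (fun x hx => by
        rw [one_mul]
        refine (hA.abs_setIntegral_act_sub_le hLf hM hE hs hx.1).trans ?_
        have := hx.2
        gcongr) r ⟨hr, le_rfl⟩
    rw [Real.norm_eq_abs] at this
    simpa [sub_right_comm] using this
  rcases le_total s r with h | h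
  · refine (hmain s r hs h).trans ?_
    nlinarith [sq_nonneg (r - s)]
  · have h1 := hmain r s hr h
    have h2 := hA.abs_setIntegral_act_sub_le hLf hM hE hr h
    have e : k r - k s - (r - s) * k' s
        = -(k s - k r - (s - r) * k' r) + (s - r) * (k' s - k' r) := by ring
    rw [e]
    refine (abs_add_le _ _).trans ?_
    rw [abs_neg, abs_mul, abs_of_nonneg (sub_nonneg.2 h)]
    have := mul_le_mul_of_nonneg_left h2 (sub_nonneg.2 h)
    change _ * |k' s - k' r| ≤ _ at this
    nlinarith

end IsGoodFamily

end MarkovSemigroup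

/-! ### The diffusion property -/

lemma hasFDerivAt_eval {n : ℕ} (i : Fin n) (x : Fin n → ℝ) :
    HasFDerivAt (fun x : Fin n → ℝ => x i)
      (ContinuousLinearMap.proj (R := ℝ) (φ := fun _ : Fin n => ℝ) i) x :=
  (ContinuousLinearMap.proj (R := ℝ) (φ := fun _ : Fin n => ℝ) i).hasFDerivAt

lemma partialDeriv_comp_eval {n : ℕ} (i j : Fin n) {ψ ψ' : ℝ → ℝ}
    (h : ∀ x, HasDerivAt ψ (ψ' x) x) :
    partialDeriv i (fun x : Fin n → ℝ => ψ (x j)) =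
      fun x => ψ' (x j) * (if j = i then 1 else 0) := by
  ext x
  have h2 := (h (x j)).comp_hasFDerivAt x (hasFDerivAt_eval j x)
  rw [partialDeriv, show (fun x : Fin n → ℝ => ψ (x j)) = ψ ∘ fun x => x j from rfl, h2.fderiv]
  simp [Pi.single_apply]

lemma partialDeriv_comp_eval_mul {n : ℕ} (i j k : Fin n) {ψ ψ' : ℝ → ℝ}
    (h : ∀ x, HasDerivAt ψ (ψ' x) x) :
    partialDeriv i (fun x : Fin n → ℝ => ψ (x j) * x k) =
      fun x => ψ (x j) * (if k = i then 1 else 0) +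
        x k * (ψ' (x j) * (if j = i then 1 else 0)) := by
  ext x
  have h2 := ((h (x j)).comp_hasFDerivAt x (hasFDerivAt_eval j x)).mul (hasFDerivAt_eval k x)
  rw [partialDeriv, show (fun x : Fin n → ℝ => ψ (x j) * x k) =
    (ψ ∘ fun x => x j) * fun x => x k from rfl, h2.fderiv]
  simp [Pi.single_apply]

lemma partialDeriv_mul_eval {n : ℕ} (i j k : Fin n) :
    partialDeriv i (fun x : Fin n → ℝ => x j * x k) =
      fun x => x j * (if k = i then 1 else 0) + x k * (if j = i then 1 else 0) := by
  ext x
  rw [partialDeriv, ((hasFDerivAt_eval j x).fun_mul (hasFDerivAt_eval k x)).fderiv]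
  simp [Pi.single_apply]

lemma partialDeriv_mul_mul_eval {n : ℕ} (i j k l : Fin n) :
    partialDeriv i (fun x : Fin n → ℝ => x j * x k * x l) =
      fun x => x j * x k * (if l = i then 1 else 0) +
        x l * (x j * (if k = i then 1 else 0) + x k * (if j = i then 1 else 0)) := by
  ext x
  rw [partialDeriv,
    (((hasFDerivAt_eval j x).fun_mul (hasFDerivAt_eval k x)).fun_mul (hasFDerivAt_eval l x)).fderiv]
  simp [Pi.single_apply, mul_add]

namespace MarkovSemigroup

variable {X : Type*} [MeasurableSpace X] {μ : Measure X} [IsProbabilityMeasure μ]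
variable {S : MarkovSemigroup μ} {A : Set (X → ℝ)} {f g h u v w : X → ℝ}

lemma carre_comm (S : MarkovSemigroup μ) (f g : X → ℝ) : S.carre f g = S.carre g f := by
  ext x
  have : (fun y => f y * g y) = fun y => g y * f y := by ext y; ring
  rw [carre, carre, this]
  ring

lemma gen_mul_eq (S : MarkovSemigroup μ) (f g : X → ℝ) (x : X) :
    S.gen (fun y => f y * g y) x = f x * S.gen g x + g x * S.gen f x + 2 * S.carre f g x := by
  rw [carre]; ring

namespace IsGoodFamily

lemma carre_congr (hA : S.IsGoodFamily A) {f' g' : X → ℝ} (hf : f ∈ A) (hg : g ∈ A)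
    (ef : f =ᵐ[μ] f') (eg : g =ᵐ[μ] g') : S.carre f g =ᵐ[μ] S.carre f' g' := by
  filter_upwards [ef, eg, S.gen_congr ef (hA.memDomain _ hf), S.gen_congr eg (hA.memDomain _ hg),
    S.gen_congr (ef.mul eg) (hA.memDomain _ (hA.mul_mem hf hg))] with x h1 h2 h3 h4 h5
  have h5' : S.gen (fun y => f y * g y) x = S.gen (fun y => f' y * g' y) x := h5
  rw [carre, carre, h1, h2, h3, h4, h5']

lemma carre_add_right (hA : S.IsGoodFamily A) (hu : u ∈ A) (hf : f ∈ A) (hg : g ∈ A) :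
    S.carre u (fun x => f x + g x) =ᵐ[μ] fun x => S.carre u f x + S.carre u g x := by
  have e : (fun y => u y * (f y + g y)) = fun y => u y * f y + u y * g y := by
    ext y; ring
  filter_upwards [S.gen_add (hA.memDomain _ hf) (hA.memDomain _ hg),
    S.gen_add (hA.memDomain _ (hA.mul_mem hu hf)) (hA.memDomain _ (hA.mul_mem hu hg))] with x h1 h2
  simp only [carre, e, h1, h2]
  ring

lemma carre_const_mul (hA : S.IsGoodFamily A) (c : ℝ) (hf : f ∈ A) :
    S.carre (fun x => c * f x) (fun x => c * f x) =ᵐ[μ] fun x => c ^ 2 * S.carre f f x := by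
  have e : (fun y => c * f y * (c * f y)) = fun y => c ^ 2 * (f y * f y) := by
    ext y; ring
  filter_upwards [S.gen_const_mul c (hA.memDomain _ hf),
    S.gen_const_mul (c ^ 2) (hA.memDomain _ (hA.mul_mem hf hf))] with x h1 h2
  simp only [carre, e, h1, h2]
  ring

end IsGoodFamily

namespace IsDiffusion

lemma gen_comp (hd : S.IsDiffusion A) {ψ ψ' ψ'' : ℝ → ℝ} (hψ : ContDiff ℝ ∞ ψ)
    (h1 : ∀ x, HasDerivAt ψ (ψ' x) x) (h2 : ∀ x, HasDerivAt ψ' (ψ'' x) x) (hf : f ∈ A) :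
    S.gen (fun x => ψ (f x)) =ᵐ[μ]
      fun x => ψ' (f x) * S.gen f x + ψ'' (f x) * S.carre f f x := by
  filter_upwards [hd 1 (fun x => ψ (x 0)) (hψ.comp (by fun_prop)) (fun _ => f) fun _ => hf]
    with x hx
  simpa [partialDeriv_comp_eval 0 0 h1, partialDeriv_comp_eval 0 0 h2] using hx

/-- The generator of a product of three functions determines how `Γ(f, ·)` acts on products. -/
lemma carre_mul_right (hd : S.IsDiffusion A) (hf : f ∈ A) (hg : g ∈ A) (hh : h ∈ A) :
    S.carre f (fun x => g x * h x) =ᵐ[μ] fun x => g x * S.carre f h x + h x * S.carre f g x := by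
  have := hd 3 (fun x => x 0 * x 1 * x 2) (by fun_prop) ![f, g, h]
    (by simp [Fin.forall_fin_succ, hf, hg, hh])
  have p0 : partialDeriv (0 : Fin 3) (fun x => x 0 * x 1 * x 2) = fun x => x 1 * x 2 := by
    rw [partialDeriv_mul_mul_eval]; ext x; simp [mul_comm]
  have p1 : partialDeriv (1 : Fin 3) (fun x => x 0 * x 1 * x 2) = fun x => x 0 * x 2 := by
    rw [partialDeriv_mul_mul_eval]; ext x; simp [mul_comm]
  have p2 : partialDeriv (2 : Fin 3) (fun x => x 0 * x 1 * x 2) = fun x => x 0 * x 1 := by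
    rw [partialDeriv_mul_mul_eval]; ext x; simp
  simp only [Fin.sum_univ_three, p0, p1, p2, partialDeriv_mul_eval] at this
  filter_upwards [this] with x hx
  have e1 := S.gen_mul_eq f (fun y => g y * h y) x
  have e2 := S.gen_mul_eq g h x
  have e3 : (fun y => f y * (g y * h y)) = fun y => f y * g y * h y := by ext y; ring
  simp at hx
  rw [e3, e2, hx, S.carre_comm g f, S.carre_comm h f, S.carre_comm h g] at e1
  linarith

lemma gen_exp (hd : S.IsDiffusion A) (hu : u ∈ A) :
    S.gen (fun x => Real.exp (u x)) =ᵐ[μ]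
      fun x => Real.exp (u x) * (S.gen u x + S.carre u u x) := by
  filter_upwards [hd.gen_comp Real.contDiff_exp Real.hasDerivAt_exp Real.hasDerivAt_exp hu]
    with x hx
  rw [hx]; ring

lemma carre_exp (hd : S.IsDiffusion A) (hu : u ∈ A) (hg : g ∈ A) :
    S.carre g (fun x => Real.exp (u x)) =ᵐ[μ] fun x => Real.exp (u x) * S.carre g u x := by
  have := hd 2 (fun x => Real.exp (x 0) * x 1) (by fun_prop) ![u, g]
    (by simp [Fin.forall_fin_two, hu, hg])
  have p0 : partialDeriv (0 : Fin 2) (fun x => Real.exp (x 0) * x 1) =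
      fun x => Real.exp (x 0) * x 1 := by
    rw [partialDeriv_comp_eval_mul _ _ _ Real.hasDerivAt_exp]; ext x; simp [mul_comm]
  have p1 : partialDeriv (1 : Fin 2) (fun x => Real.exp (x 0) * x 1) =
      fun x => Real.exp (x 0) := by
    rw [partialDeriv_comp_eval_mul _ _ _ Real.hasDerivAt_exp]; ext x; simp
  simp only [Fin.sum_univ_two, p0, p1, partialDeriv_comp_eval _ _ Real.hasDerivAt_exp] at this
  filter_upwards [this, hd.gen_exp hu] with x hx e2
  have e3 := S.gen_mul_eq (fun y => Real.exp (u y)) g x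
  simp only [Matrix.cons_val_zero, Matrix.cons_val_one, if_true, if_neg zero_ne_one, mul_one,
    mul_zero, zero_mul, add_zero] at hx
  rw [hx, e2, S.carre_comm (fun y => Real.exp (u y)) g, S.carre_comm u g] at e3
  linarith

end IsDiffusion

/-! ### Static identities for the entropy functional -/

namespace IsGoodFamily

lemma integrable_mul (hA : S.IsGoodFamily A) (hf : f ∈ A) (hg : g ∈ A) :
    Integrable (fun x => f x * g x) μ := hA.integrable (hA.mul_mem hf hg)

lemma integral_gen_mul (hA : S.IsGoodFamily A) (hf : f ∈ A) (hg : g ∈ A) :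
    ∫ x, S.gen f x * g x ∂μ = ∫ x, f x * S.gen g x ∂μ :=
  S.integral_gen_mul (hA.memDomain _ hf) (hA.memDomain _ hg)

/-- The integrated form of `L(Φ(h)) - Φ'(h) L h = Φ''(h) Γ(h)` for `Φ(h) = h log h`, `h = e^u`. -/
lemma integral_entropy_first (hA : S.IsGoodFamily A) (hd : S.IsDiffusion A) (hu : u ∈ A)
    (hw : w ∈ A) :
    ∫ x, (S.gen w x * (Real.exp (u x) * u x) -
        w x * (1 + u x) * S.gen (fun y => Real.exp (u y)) x) ∂μ =
      ∫ x, w x * (Real.exp (u x) * S.carre u u x) ∂μ := by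
  have he := hA.exp_mem hu
  have h1u := hA.add_mem (hA.const 1) hu
  rw [integral_sub (hA.integrable_mul (hA.gen_mem _ hw) (hA.mul_mem he hu))
    (hA.integrable_mul (hA.mul_mem hw h1u) (hA.gen_mem _ he)),
    hA.integral_gen_mul hw (hA.mul_mem he hu),
    ← integral_sub (hA.integrable_mul hw (hA.gen_mem _ (hA.mul_mem he hu)))
    (hA.integrable_mul (hA.mul_mem hw h1u) (hA.gen_mem _ he))]
  refine integral_congr_ae ?_
  filter_upwards [hd.gen_exp hu, hd.carre_exp hu hu] with x h1 h2
  rw [S.gen_mul_eq, S.carre_comm, h1, h2]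
  ring

/-- The second derivative of the interpolation. After moving `L` and `L²` from `w` onto the other
factors, the integrand is `w` times
`L²(Φ(h)) - 2 L(Φ'(h) L h) + Φ''(h) (L h)² + Φ'(h) L² h = 2 h Γ₂(log h)`
for `Φ(h) = h log h` and `h = e^u`. -/
lemma integral_entropy_second (hA : S.IsGoodFamily A) (hd : S.IsDiffusion A) (hu : u ∈ A)
    (hw : w ∈ A) :
    ∫ x, (S.gen (S.gen w) x * (Real.exp (u x) * u x) -
        2 * (S.gen w x * ((1 + u x) * S.gen (fun y => Real.exp (u y)) x)) +
        w x * (S.gen (fun y => Real.exp (u y)) x ^ 2 / Real.exp (u x) +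
          (1 + u x) * S.gen (S.gen (fun y => Real.exp (u y))) x)) ∂μ =
      ∫ x, w x * (2 * (Real.exp (u x) * S.carreTwo u u x)) ∂μ := by
  set e : X → ℝ := fun y => Real.exp (u y) with he_def
  set q : X → ℝ := S.carre u u with hq_def
  have he : e ∈ A := hA.exp_mem hu
  have hq : q ∈ A := hA.carre_mem hu hu
  have h1u := hA.add_mem (hA.const 1) hu
  have hLw := hA.gen_mem _ hw
  have hLe := hA.gen_mem _ he
  have hLu := hA.gen_mem _ hu
  have heu := hA.mul_mem he hu
  have hk := hA.mul_mem h1u hLe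
  have heq := hA.mul_mem he hq
  -- the remaining term of the integrand is replaced by an element of the family
  set r : X → ℝ := fun x => e x * ((S.gen u x + q x) * (S.gen u x + q x)) +
    (1 + u x) * S.gen (S.gen e) x with hr_def
  have hvq := hA.add_mem hLu hq
  have hr : r ∈ A := hA.add_mem (hA.mul_mem he (hA.mul_mem hvq hvq))
    (hA.mul_mem h1u (hA.gen_mem _ hLe))
  have hexp := hd.gen_exp hu
  have step1 : ∫ x, (S.gen (S.gen w) x * (Real.exp (u x) * u x) -
        2 * (S.gen w x * ((1 + u x) * S.gen e x)) +
        w x * (S.gen e x ^ 2 / Real.exp (u x) + (1 + u x) * S.gen (S.gen e) x)) ∂μ =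
      ∫ x, (S.gen (S.gen w) x * (e x * u x) - 2 * (S.gen w x * ((1 + u x) * S.gen e x)) +
        w x * r x) ∂μ := by
    refine integral_congr_ae ?_
    filter_upwards [hexp] with x hx
    have hx' : S.gen e x = e x * (S.gen u x + q x) := hx
    have h0 : e x ≠ 0 := (Real.exp_pos _).ne'
    have h2 : S.gen e x ^ 2 / e x = e x * ((S.gen u x + q x) * (S.gen u x + q x)) := by
      rw [hx']; field_simp
    simp only [hr_def]
    rw [← h2]
  have i1 := hA.integrable_mul (hA.gen_mem _ hLw) heu
  have i2 := (hA.integrable_mul hLw hk).const_mul 2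
  have i3 := hA.integrable_mul hw hr
  have step2 : ∫ x, (S.gen (S.gen w) x * (e x * u x) -
        2 * (S.gen w x * ((1 + u x) * S.gen e x)) + w x * r x) ∂μ =
      ∫ x, (w x * S.gen (S.gen fun y => e y * u y) x -
        2 * (w x * S.gen (fun y => (1 + u y) * S.gen e y) x) + w x * r x) ∂μ := by
    have j1 := hA.integrable_mul hw (hA.gen_mem _ (hA.gen_mem _ heu))
    have j2 := (hA.integrable_mul hw (hA.gen_mem _ hk)).const_mul 2
    have i12 : Integrable (fun x => S.gen (S.gen w) x * (e x * u x) -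
      2 * (S.gen w x * ((1 + u x) * S.gen e x))) μ := i1.sub i2
    have j12 : Integrable (fun x => w x * S.gen (S.gen fun y => e y * u y) x -
      2 * (w x * S.gen (fun y => (1 + u y) * S.gen e y) x)) μ := j1.sub j2
    rw [integral_add i12 i3, integral_sub i1 i2, integral_const_mul,
      hA.integral_gen_mul hLw heu, hA.integral_gen_mul hw (hA.gen_mem _ heu),
      hA.integral_gen_mul hw hk, integral_add j12 i3, integral_sub j1 j2,
      integral_const_mul]
  rw [step1, step2]
  refine integral_congr_ae ?_
  -- `L(Φ(h)) = (1 + u) L h + h Γ(u)`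
  have a1 : S.gen (fun y => e y * u y) =ᵐ[μ] fun y => (1 + u y) * S.gen e y + e y * q y := by
    filter_upwards [hexp, hd.carre_exp hu hu] with x h1 h2
    have h1' : S.gen e x = e x * (S.gen u x + q x) := h1
    have h2' : S.carre u e x = e x * q x := h2
    rw [S.gen_mul_eq, S.carre_comm, h2', h1']
    ring
  have a2 : S.gen (S.gen fun y => e y * u y) =ᵐ[μ]
      fun x => S.gen (fun y => (1 + u y) * S.gen e y) x + S.gen (fun y => e y * q y) x :=
    (S.gen_congr a1 (hA.memDomain _ (hA.gen_mem _ heu))).trans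
      (S.gen_add (hA.memDomain _ hk) (hA.memDomain _ heq))
  -- `L(1 + u) = L u` and `Γ(1 + u, ·) = Γ(u, ·)`, both through `(1 + u) k = k + u k`
  have a3 : S.gen (fun y => (1 + u y) * S.gen e y) =ᵐ[μ]
      fun x => S.gen (S.gen e) x + S.gen (fun y => u y * S.gen e y) x := by
    have : (fun y => (1 + u y) * S.gen e y) = fun y => S.gen e y + u y * S.gen e y := by
      ext y; ring
    rw [this]
    exact S.gen_add (hA.memDomain _ hLe) (hA.memDomain _ (hA.mul_mem hu hLe))
  -- `Γ(u, L h) = h Γ(u) (L u + Γ(u)) + h (Γ(u, L u) + Γ(u, Γ(u)))`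
  have a4 : S.carre u (S.gen e) =ᵐ[μ] fun x => e x * (S.carre u (S.gen u) x + S.carre u q x) +
      (S.gen u x + q x) * (e x * q x) := by
    filter_upwards [hA.carre_congr hu hLe EventuallyEq.rfl hexp, hd.carre_mul_right hu he hvq,
      hA.carre_add_right hu hLu hq, hd.carre_exp hu hu] with x h1 h2 h3 h4
    have h4' : S.carre u e x = e x * q x := h4
    rw [h1, h2, h3, h4']
  filter_upwards [a2, a3, a4, hexp, hd.carre_exp hu hq] with x h2 h3 h4 h5 h6
  have h5' : S.gen e x = e x * (S.gen u x + q x) := h5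
  have h10 : S.carre e q x = e x * S.carre u q x := by
    rw [S.carre_comm e q, S.carre_comm u q]; exact h6
  have hG : S.carreTwo u u x = 1 / 2 * (S.gen q x - S.carre u (S.gen u) x -
      S.carre u (S.gen u) x) := rfl
  rw [h2, h3, hG, S.gen_mul_eq u (S.gen e), h4, S.gen_mul_eq e q, h10, h5']
  simp only [hr_def]
  ring

end IsGoodFamily

end MarkovSemigroup

/-! ### The local logarithmic Sobolev inequality -/

namespace MarkovSemigroup

variable {X : Type*} [MeasurableSpace X] {μ : Measure X} [IsProbabilityMeasure μ]

/-- The integrand of `φ(s) = ∫ P_s w · h_s log h_s dμ`, where `h_s = P_{t-s} e^f`. -/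
noncomputable def entropyCurve (S : MarkovSemigroup μ) (t : ℝ) (f w : X → ℝ) :
    ℝ → X → ℝ := fun s x =>
  S.act s w x * (S.act (t - s) (fun y => Real.exp (f y)) x *
    Real.log (S.act (t - s) (fun y => Real.exp (f y)) x))

/-- The integrand of `φ'(s)`, which involves no derivative of a nonlinear function of `h_s`. -/
noncomputable def entropyCurve' (S : MarkovSemigroup μ) (t : ℝ) (f w : X → ℝ) :
    ℝ → X → ℝ := fun s x =>
  S.act s (S.gen w) x * (S.act (t - s) (fun y => Real.exp (f y)) x *
    Real.log (S.act (t - s) (fun y => Real.exp (f y)) x)) -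
  S.act s w x * (1 + Real.log (S.act (t - s) (fun y => Real.exp (f y)) x)) *
    S.act (t - s) (S.gen fun y => Real.exp (f y)) x

/-- The integrand of `φ''(s)`. -/
noncomputable def entropyCurve'' (S : MarkovSemigroup μ) (t : ℝ) (f w : X → ℝ) :
    ℝ → X → ℝ := fun s x =>
  S.act s (S.gen (S.gen w)) x * (S.act (t - s) (fun y => Real.exp (f y)) x *
    Real.log (S.act (t - s) (fun y => Real.exp (f y)) x)) -
  2 * (S.act s (S.gen w) x * ((1 + Real.log (S.act (t - s) (fun y => Real.exp (f y)) x)) *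
    S.act (t - s) (S.gen fun y => Real.exp (f y)) x)) +
  S.act s w x * (S.act (t - s) (S.gen fun y => Real.exp (f y)) x ^ 2 /
      S.act (t - s) (fun y => Real.exp (f y)) x +
    (1 + Real.log (S.act (t - s) (fun y => Real.exp (f y)) x)) *
      S.act (t - s) (S.gen (S.gen fun y => Real.exp (f y))) x)

namespace IsGoodFamily

variable {S : MarkovSemigroup μ} {A : Set (X → ℝ)} {f g h u v w : X → ℝ} {s t : ℝ}

lemma exists_le_exp (hA : S.IsGoodFamily A) (hf : f ∈ A) :
    ∃ m, 0 < m ∧ ∀ᵐ x ∂μ, m ≤ Real.exp (f x) := by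
  obtain ⟨C, -, hC⟩ := hA.exists_abs_le hf
  exact ⟨Real.exp (-C), Real.exp_pos _, hC.mono fun x hx => Real.exp_le_exp.2 (abs_le.1 hx).1⟩

lemma exists_le_act_exp (hA : S.IsGoodFamily A) (hf : f ∈ A) :
    ∃ m, 0 < m ∧ ∀ t : ℝ, 0 ≤ t → ∀ᵐ x ∂μ, m ≤ S.act t (fun y => Real.exp (f y)) x := by
  obtain ⟨m, hm, h⟩ := hA.exists_le_exp hf
  exact ⟨m, hm, fun t ht => S.le_act (hA.memLp_two (hA.exp_mem hf)) h ht⟩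

lemma exists_act_exp_eq (hA : S.IsGoodFamily A) (hf : f ∈ A) (ht : 0 ≤ t) :
    ∃ u ∈ A, ∀ᵐ x ∂μ, S.act t (fun y => Real.exp (f y)) x = Real.exp (u x) := by
  obtain ⟨m, hm, h⟩ := hA.exists_le_act_exp hf
  exact hA.exists_exp_eq (hA.act_mem_of_nonneg (hA.exp_mem hf) ht) hm (h t ht)

/-- An element of the family is nonpositive as soon as its integrals against squares of elements of
the family are: it suffices to test it against the square of a smooth function of itself which
vanishes exactly on `(-∞, 0]`. -/
lemma ae_nonpos_of_forall_integral_mul (hA : S.IsGoodFamily A) (hf : f ∈ A)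
    (h : ∀ v ∈ A, ∫ x, v x * v x * f x ∂μ ≤ 0) : ∀ᵐ x ∂μ, f x ≤ 0 := by
  have hv : (fun x => Real.smoothTransition (f x)) ∈ A :=
    hA.comp_mem_one Real.smoothTransition.contDiff hf
  have hnn : ∀ y : ℝ, 0 ≤ Real.smoothTransition y * Real.smoothTransition y * y := by
    intro y
    rcases le_total y 0 with hy | hy
    · rw [Real.smoothTransition.zero_of_nonpos hy]; simp
    · exact mul_nonneg (mul_self_nonneg _) hy
  have h0 : ∫ x, Real.smoothTransition (f x) * Real.smoothTransition (f x) * f x ∂μ = 0 :=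
    le_antisymm (h _ hv) (integral_nonneg fun x => hnn (f x))
  rw [integral_eq_zero_iff_of_nonneg (fun x => hnn (f x))
    (hA.integrable (hA.mul_mem (hA.mul_mem hv hv) hf))] at h0
  filter_upwards [h0] with x hx
  by_contra! hlt
  have := Real.smoothTransition.pos_of_pos hlt
  have hx' : Real.smoothTransition (f x) * Real.smoothTransition (f x) * f x = 0 := hx
  have : 0 < Real.smoothTransition (f x) * Real.smoothTransition (f x) * f x := by positivity
  linarith

lemma hasUniformDeriv_act_Icc (hA : S.IsGoodFamily A) (hw : w ∈ A) (t : ℝ) :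
    HasUniformDeriv μ (Set.Icc 0 t) (fun s => S.act s w) (fun s => S.act s (S.gen w)) :=
  (hA.hasUniformDeriv_act hw).mono fun _ hs => hs.1

lemma hasUniformDeriv_act_sub (hA : S.IsGoodFamily A) (hw : w ∈ A) (t : ℝ) :
    HasUniformDeriv μ (Set.Icc 0 t) (fun s => S.act (t - s) w)
      (fun s x => -S.act (t - s) (S.gen w) x) :=
  (hA.hasUniformDeriv_act hw).comp_const_sub fun _ hs => sub_nonneg.2 hs.2

lemma hasUniformDeriv_log_act_sub (hA : S.IsGoodFamily A) (hf : f ∈ A) (t : ℝ) :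
    HasUniformDeriv μ (Set.Icc 0 t)
      (fun s x => Real.log (S.act (t - s) (fun y => Real.exp (f y)) x))
      (fun s x => -S.act (t - s) (S.gen fun y => Real.exp (f y)) x /
        S.act (t - s) (fun y => Real.exp (f y)) x) := by
  obtain ⟨m, hm, h⟩ := hA.exists_le_act_exp hf
  exact (hA.hasUniformDeriv_act_sub (hA.exp_mem hf) t).log hm fun s hs => h _ (sub_nonneg.2 hs.2)

lemma hasUniformDeriv_entropyCurve (hA : S.IsGoodFamily A) (hf : f ∈ A) (hw : w ∈ A) (t : ℝ) :
    HasUniformDeriv μ (Set.Icc 0 t) (S.entropyCurve t f w) (S.entropyCurve' t f w) := by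
  obtain ⟨m, hm, h⟩ := hA.exists_le_act_exp hf
  refine ((hA.hasUniformDeriv_act_Icc hw t).mul ((hA.hasUniformDeriv_act_sub (hA.exp_mem hf) t).mul
    (hA.hasUniformDeriv_log_act_sub hf t))).congr (fun s _ => EventuallyEq.rfl) fun s hs => ?_
  filter_upwards [h (t - s) (sub_nonneg.2 hs.2)] with x hx
  have hx0 : S.act (t - s) (fun y => Real.exp (f y)) x ≠ 0 := (hm.trans_le hx).ne'
  simp only [entropyCurve']
  field_simp
  ring

lemma hasUniformDeriv_entropyCurve' (hA : S.IsGoodFamily A) (hf : f ∈ A) (hw : w ∈ A) (t : ℝ) :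
    HasUniformDeriv μ (Set.Icc 0 t) (S.entropyCurve' t f w) (S.entropyCurve'' t f w) := by
  obtain ⟨m, hm, h⟩ := hA.exists_le_act_exp hf
  have he := hA.exp_mem hf
  have hlog := hA.hasUniformDeriv_log_act_sub hf t
  have hone : HasUniformDeriv μ (Set.Icc 0 t) (fun _ _ => (1 : ℝ)) (fun _ _ => 0) :=
    HasUniformDeriv.of_bdd aestronglyMeasurable_const (C := 1) (by simp)
  refine (((hA.hasUniformDeriv_act_Icc (hA.gen_mem _ hw) t).mul
    ((hA.hasUniformDeriv_act_sub he t).mul hlog)).sub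
    (((hA.hasUniformDeriv_act_Icc hw t).mul (hone.add hlog)).mul
      (hA.hasUniformDeriv_act_sub (hA.gen_mem _ he) t))).congr
    (fun s _ => EventuallyEq.rfl) fun s hs => ?_
  filter_upwards [h (t - s) (sub_nonneg.2 hs.2)] with x hx
  have hx0 : S.act (t - s) (fun y => Real.exp (f y)) x ≠ 0 := (hm.trans_le hx).ne'
  simp only [entropyCurve'']
  field_simp
  ring

lemma gen_gen_act (hA : S.IsGoodFamily A) (hf : f ∈ A) (ht : 0 ≤ t) :
    S.gen (S.gen (S.act t f)) =ᵐ[μ] S.act t (S.gen (S.gen f)) :=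
  (S.gen_congr (S.gen_act (hA.memDomain f hf) ht)
    (hA.memDomain _ (hA.gen_mem _ (hA.act_mem_of_nonneg hf ht)))).trans
    (S.gen_act (hA.memDomain _ (hA.gen_mem _ hf)) ht)

lemma integral_entropyCurve' (hA : S.IsGoodFamily A) (hd : S.IsDiffusion A) (hf : f ∈ A)
    (hw : w ∈ A) (hs : s ∈ Set.Icc 0 t) (hu : u ∈ A)
    (he : ∀ᵐ x ∂μ, S.act (t - s) (fun y => Real.exp (f y)) x = Real.exp (u x)) :
    ∫ x, S.entropyCurve' t f w s x ∂μ =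
      ∫ x, S.act s w x * (Real.exp (u x) * S.carre u u x) ∂μ := by
  have hts : 0 ≤ t - s := sub_nonneg.2 hs.2
  rw [← hA.integral_entropy_first hd hu (hA.act_mem_of_nonneg hw hs.1)]
  refine integral_congr_ae ?_
  have h1 := S.gen_congr he (hA.memDomain _ (hA.act_mem_of_nonneg (hA.exp_mem hf) hts))
  filter_upwards [he, h1, S.gen_act (hA.memDomain _ (hA.exp_mem hf)) hts,
    S.gen_act (hA.memDomain _ hw) hs.1] with x e1 e2 e3 e4
  simp only [entropyCurve']
  rw [← e3, ← e4, e2, e1, Real.log_exp]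

lemma integral_entropyCurve'' (hA : S.IsGoodFamily A) (hd : S.IsDiffusion A) (hf : f ∈ A)
    (hw : w ∈ A) (hs : s ∈ Set.Icc 0 t) (hu : u ∈ A)
    (he : ∀ᵐ x ∂μ, S.act (t - s) (fun y => Real.exp (f y)) x = Real.exp (u x)) :
    ∫ x, S.entropyCurve'' t f w s x ∂μ =
      ∫ x, S.act s w x * (2 * (Real.exp (u x) * S.carreTwo u u x)) ∂μ := by
  have hts : 0 ≤ t - s := sub_nonneg.2 hs.2
  have hm := hA.act_mem_of_nonneg (hA.exp_mem hf) hts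
  rw [← hA.integral_entropy_second hd hu (hA.act_mem_of_nonneg hw hs.1)]
  refine integral_congr_ae ?_
  have h1 := S.gen_congr he (hA.memDomain _ hm)
  have h2 := S.gen_congr h1 (hA.memDomain _ (hA.gen_mem _ hm))
  filter_upwards [he, h1, h2, S.gen_act (hA.memDomain _ (hA.exp_mem hf)) hts,
    S.gen_act (hA.memDomain _ hw) hs.1, hA.gen_gen_act (hA.exp_mem hf) hts,
    hA.gen_gen_act hw hs.1] with x e1 e2 e3 e4 e5 e6 e7
  simp only [entropyCurve'']
  rw [← e4, ← e5, ← e6, ← e7, e3, e2, e1, Real.log_exp]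

lemma carreTwo_mem (hA : S.IsGoodFamily A) (hf : f ∈ A) : S.carreTwo f f ∈ A :=
  hA.const_mul_mem (1 / 2) (hA.sub_mem (hA.sub_mem (hA.gen_mem _ (hA.carre_mem hf hf))
    (hA.carre_mem hf (hA.gen_mem _ hf))) (hA.carre_mem hf (hA.gen_mem _ hf)))

/-- The local logarithmic Sobolev inequality, tested against a nonnegative function `w`. The
curvature condition at `u = log P_{t-s} e^f` gives `φ'' ≥ 2ρ φ'`. -/
lemma integral_mul_entropy_le (hA : S.IsGoodFamily A) (hd : S.IsDiffusion A) {ρ : ℝ} (hρ : 0 < ρ)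
    (hc : S.HasCurvature A ρ) (hf : f ∈ A) (hw : w ∈ A) (hw0 : 0 ≤ᵐ[μ] w) (ht : 0 < t) :
    ∫ x, S.act t w x * (Real.exp (f x) * f x) ∂μ -
      ∫ x, w x * (S.act t (fun y => Real.exp (f y)) x *
        Real.log (S.act t (fun y => Real.exp (f y)) x)) ∂μ ≤
      (1 - Real.exp (-(2 * ρ * t))) / (2 * ρ) *
        ∫ x, S.act t w x * (Real.exp (f x) * S.carre f f x) ∂μ := by
  have hmain := sub_le_of_mul_le_second_deriv hρ ht
    (fun s hs => (hA.hasUniformDeriv_entropyCurve hf hw t).hasDerivWithinAt_integral hs)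
    (fun s hs => (hA.hasUniformDeriv_entropyCurve' hf hw t).hasDerivWithinAt_integral hs)
    (by
      intro s hs
      obtain ⟨u, hu, he⟩ := hA.exists_act_exp_eq hf (sub_nonneg.2 hs.2)
      have hws := hA.act_mem_of_nonneg hw hs.1
      rw [hA.integral_entropyCurve' hd hf hw hs hu he,
        hA.integral_entropyCurve'' hd hf hw hs hu he, ← integral_const_mul]
      refine integral_mono_ae ((hA.integrable_mul hws (hA.mul_mem (hA.exp_mem hu)
        (hA.carre_mem hu hu))).const_mul _) (hA.integrable_mul hws (hA.const_mul_mem 2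
        (hA.mul_mem (hA.exp_mem hu) (hA.carreTwo_mem hu)))) ?_
      filter_upwards [hc u hu, S.act_nonneg hw0 hs.1] with x h1 h2
      have h3 := mul_le_mul_of_nonneg_left h1
        (mul_nonneg (mul_nonneg zero_le_two h2) (Real.exp_pos (u x)).le)
      linarith)
  have h0 : ∀ᵐ x ∂μ, S.act (t - t) (fun y => Real.exp (f y)) x = Real.exp (f x) := by
    rw [sub_self]; exact S.act_zero (hA.memLp_two (hA.exp_mem hf))
  rw [hA.integral_entropyCurve' hd hf hw ⟨ht.le, le_rfl⟩ hf h0] at hmain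
  have e1 : ∫ x, S.entropyCurve t f w t x ∂μ =
      ∫ x, S.act t w x * (Real.exp (f x) * f x) ∂μ := by
    refine integral_congr_ae ?_
    filter_upwards [h0] with x hx
    simp only [entropyCurve]
    rw [hx, Real.log_exp]
  have e2 : ∫ x, S.entropyCurve t f w 0 x ∂μ =
      ∫ x, w x * (S.act t (fun y => Real.exp (f y)) x *
        Real.log (S.act t (fun y => Real.exp (f y)) x)) ∂μ := by
    refine integral_congr_ae ?_
    filter_upwards [S.act_zero (hA.memLp_two hw)] with x hx
    simp only [entropyCurve]
    rw [hx, sub_zero]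
  rwa [e1, e2] at hmain

/-- The local logarithmic Sobolev inequality for `P_t` at `e^f`. -/
theorem local_logSobolev (hA : S.IsGoodFamily A) (hd : S.IsDiffusion A) {ρ : ℝ} (hρ : 0 < ρ)
    (hc : S.HasCurvature A ρ) (hf : f ∈ A) (ht : 0 < t) :
    ∀ᵐ x ∂μ, S.act t (fun y => Real.exp (f y) * f y) x -
      S.act t (fun y => Real.exp (f y)) x * Real.log (S.act t (fun y => Real.exp (f y)) x) ≤
      (1 - Real.exp (-(2 * ρ * t))) / (2 * ρ) *
        S.act t (fun y => Real.exp (f y) * S.carre f f y) x := by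
  set c := (1 - Real.exp (-(2 * ρ * t))) / (2 * ρ)
  obtain ⟨u, hu, he⟩ := hA.exists_act_exp_eq hf ht.le
  have m1 := hA.mul_mem (hA.exp_mem hf) hf
  have m2 := hA.mul_mem (hA.exp_mem hu) hu
  have m3 := hA.mul_mem (hA.exp_mem hf) (hA.carre_mem hf hf)
  have n1 := hA.act_mem t ht _ m1
  have n3 := hA.act_mem t ht _ m3
  have hdm := hA.sub_mem (hA.sub_mem n1 m2) (hA.const_mul_mem c n3)
  have key := hA.ae_nonpos_of_forall_integral_mul hdm (fun v hv => by
    have hvv := hA.mul_mem hv hv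
    have h1 := hA.integral_mul_entropy_le hd hρ hc hf hvv
      (Eventually.of_forall fun x => mul_self_nonneg (v x)) ht
    rw [S.integral_act_mul (hA.memLp_two hvv) (hA.memLp_two m1) ht.le,
      S.integral_act_mul (hA.memLp_two hvv) (hA.memLp_two m3) ht.le] at h1
    have h2 : ∫ x, v x * v x * (S.act t (fun y => Real.exp (f y)) x *
        Real.log (S.act t (fun y => Real.exp (f y)) x)) ∂μ =
        ∫ x, v x * v x * (Real.exp (u x) * u x) ∂μ := by
      refine integral_congr_ae ?_
      filter_upwards [he] with x hx
      rw [hx, Real.log_exp]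
    rw [h2, ← integral_const_mul, ← integral_sub (hA.integrable_mul hvv n1)
      (hA.integrable_mul hvv m2)] at h1
    have i1 : Integrable (fun x => v x * v x * S.act t (fun y => Real.exp (f y) * f y) x -
      v x * v x * (Real.exp (u x) * u x)) μ :=
      (hA.integrable_mul hvv n1).sub (hA.integrable_mul hvv m2)
    rw [← sub_nonpos, ← integral_sub i1 ((hA.integrable_mul hvv n3).const_mul c)] at h1
    refine le_of_eq_of_le (integral_congr_ae (Eventually.of_forall fun x => ?_)) h1
    ring)
  filter_upwards [key, he] with x h1 h2
  rw [h2, Real.log_exp]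
  linarith

end IsGoodFamily

end MarkovSemigroup

/-! ### The entropy inequality and Herbst's argument -/

namespace MarkovSemigroup

variable {X : Type*} [MeasurableSpace X] {μ : Measure X} [IsProbabilityMeasure μ]
variable {S : MarkovSemigroup μ} {A : Set (X → ℝ)} {f g h k u v w : X → ℝ} {s t : ℝ}

lemma _root_.HasUniformDeriv.act {I : Set ℝ} {a a' : ℝ → X → ℝ} (S : MarkovSemigroup μ)
    (ha : HasUniformDeriv μ I a a') (ht : 0 ≤ t) :
    HasUniformDeriv μ I (fun s => S.act t (a s)) (fun s => S.act t (a' s)) := by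
  obtain ⟨C, hC0, hC⟩ := ha.bdd
  obtain ⟨C', hC0', hC'⟩ := ha.bdd'
  obtain ⟨E, hE0, hE⟩ := ha.expansion
  have m : ∀ s ∈ I, MemLp (a s) 2 μ := fun s hs => MemLp.of_bound (ha.aesm s hs) C (hC s hs)
  have m' : ∀ s ∈ I, MemLp (a' s) 2 μ := fun s hs => MemLp.of_bound (ha.aesm' s hs) C' (hC' s hs)
  refine ⟨fun s _ => (S.memLp_act t _).aestronglyMeasurable,
    fun s _ => (S.memLp_act t _).aestronglyMeasurable,
    ⟨C, hC0, fun s hs => S.abs_act_le (m s hs) (hC s hs) ht⟩,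
    ⟨C', hC0', fun s hs => S.abs_act_le (m' s hs) (hC' s hs) ht⟩, E, hE0, fun s hs r hr => ?_⟩
  have m1 : MemLp (fun x => a r x - a s x) 2 μ := (m r hr).sub (m s hs)
  have m2 : MemLp (fun x => (r - s) * a' s x) 2 μ := (m' s hs).const_mul _
  filter_upwards [S.abs_act_le (m1.sub m2) (hE s hs r hr) ht, S.act_sub m1 m2 t,
    S.act_sub (m r hr) (m s hs) t, S.act_const_mul (r - s) (m' s hs) t] with x h1 h2 h3 h4
  rw [← h3, ← h4, ← h2]
  exact h1

namespace IsGoodFamily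

/-- The variational formula of the entropy for the operator `P_t`. The inequality
`h ≤ k + (r - 1) + e^{h - r - k}` gives it with a constant `r` in place of `log (Z / G)`, where
`G = P_t e^k` and `Z = P_t e^h`; it holds outside a common null set for all rational `r`, hence for
all real `r`, and `r` may then depend on the point. -/
lemma act_exp_mul_le (hA : S.IsGoodFamily A) (hh : h ∈ A) (hk : k ∈ A) (ht : 0 ≤ t) :
    ∀ᵐ x ∂μ, S.act t (fun y => Real.exp (k y) * h y) x ≤
      S.act t (fun y => Real.exp (k y) * k y) x -
        S.act t (fun y => Real.exp (k y)) x * Real.log (S.act t (fun y => Real.exp (k y)) x) +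
        S.act t (fun y => Real.exp (k y)) x * Real.log (S.act t (fun y => Real.exp (h y)) x) := by
  have ek := hA.exp_mem hk
  have eh := hA.exp_mem hh
  have hkk := hA.mul_mem ek hk
  have hkh := hA.mul_mem ek hh
  have hq : ∀ r : ℚ, ∀ᵐ x ∂μ, S.act t (fun y => Real.exp (k y) * h y) x ≤
      S.act t (fun y => Real.exp (k y) * k y) x +
        (((r : ℝ) - 1) * S.act t (fun y => Real.exp (k y)) x +
          Real.exp (-(r : ℝ)) * S.act t (fun y => Real.exp (h y)) x) := by
    intro r
    have c1 := hA.const_mul_mem ((r : ℝ) - 1) ek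
    have c2 := hA.const_mul_mem (Real.exp (-(r : ℝ))) eh
    have c3 := hA.add_mem c1 c2
    have hle : (fun y => Real.exp (k y) * h y) ≤ᵐ[μ] fun y => Real.exp (k y) * k y +
        (((r : ℝ) - 1) * Real.exp (k y) + Real.exp (-(r : ℝ)) * Real.exp (h y)) := by
      refine Eventually.of_forall fun y => ?_
      have h1 := Real.add_one_le_exp (h y - r - k y)
      have h2 : Real.exp (-(r : ℝ)) * Real.exp (h y) =
          Real.exp (k y) * Real.exp (h y - r - k y) := by
        rw [← Real.exp_add, ← Real.exp_add]; congr 1; ring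
      have h3 := mul_le_mul_of_nonneg_left h1 (Real.exp_pos (k y)).le
      simp only [h2]
      linarith
    filter_upwards [S.act_mono (hA.memLp_two hkh) (hA.memLp_two (hA.add_mem hkk c3)) hle ht,
      S.act_add (hA.memLp_two hkk) (hA.memLp_two c3) t,
      S.act_add (hA.memLp_two c1) (hA.memLp_two c2) t,
      S.act_const_mul ((r : ℝ) - 1) (hA.memLp_two ek) t,
      S.act_const_mul (Real.exp (-(r : ℝ))) (hA.memLp_two eh) t] with x h1 h2 h3 h4 h5
    rwa [h2, h3, h4, h5] at h1
  obtain ⟨m, hm, hmk⟩ := hA.exists_le_act_exp hk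
  obtain ⟨n, hn, hnh⟩ := hA.exists_le_act_exp hh
  filter_upwards [ae_all_iff.2 hq, hmk t ht, hnh t ht] with x hx hG hZ
  set G := S.act t (fun y => Real.exp (k y)) x
  set Z := S.act t (fun y => Real.exp (h y)) x
  have hG0 : 0 < G := hm.trans_le hG
  have hZ0 : 0 < Z := hn.trans_le hZ
  have hr : ∀ r : ℝ, S.act t (fun y => Real.exp (k y) * h y) x ≤
      S.act t (fun y => Real.exp (k y) * k y) x + ((r - 1) * G + Real.exp (-r) * Z) := by
    intro r
    refine Rat.denseRange_cast.induction_on r ?_ hx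
    exact isClosed_le continuous_const (by fun_prop)
  have h1 := hr (Real.log Z - Real.log G)
  have h2 : Real.exp (-(Real.log Z - Real.log G)) * Z = G := by
    rw [neg_sub, Real.exp_sub, Real.exp_log hG0, Real.exp_log hZ0]
    field_simp
  rw [h2] at h1
  linarith

/-- The logarithmic Sobolev inequality at `e^{l f}` combined with the variational formula of the
entropy for the function `α Γ(f)`. -/
lemma entropy_exp_mul_le (hA : S.IsGoodFamily A) (hd : S.IsDiffusion A) {ρ α : ℝ} (hρ : 0 < ρ)
    (hc : S.HasCurvature A ρ) (hf : f ∈ A) (ht : 0 < t)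
    (hc0 : 0 < (1 - Real.exp (-(2 * ρ * t))) / (2 * ρ))
    (hα : (1 - Real.exp (-(2 * ρ * t))) / (2 * ρ) < α) {l : ℝ} (hl : l ∈ Set.Ioc (0 : ℝ) 1) :
    ∀ᵐ x ∂μ, l * (S.act t (fun y => f y * Real.exp (l * f y)) x /
        S.act t (fun y => Real.exp (l * f y)) x) -
      Real.log (S.act t (fun y => Real.exp (l * f y)) x) ≤
      (1 - Real.exp (-(2 * ρ * t))) / (2 * ρ) * l ^ 2 /
        (α - (1 - Real.exp (-(2 * ρ * t))) / (2 * ρ) * l ^ 2) *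
        Real.log (S.act t (fun y => Real.exp (α * S.carre f f y)) x) := by
  set c := (1 - Real.exp (-(2 * ρ * t))) / (2 * ρ)
  have hk := hA.const_mul_mem l hf
  have hek := hA.exp_mem hk
  have hG := hA.carre_mem hf hf
  have e1 : (fun y => Real.exp (l * f y) * S.carre (fun x => l * f x) (fun x => l * f x) y) =ᵐ[μ]
      fun y => l ^ 2 * (Real.exp (l * f y) * S.carre f f y) := by
    filter_upwards [hA.carre_const_mul l hf] with x hx
    rw [hx]; ring
  have e2 : (fun y => Real.exp (l * f y) * (α * S.carre f f y)) =
      fun y => α * (Real.exp (l * f y) * S.carre f f y) := by ext y; ring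
  have e3 : (fun y => Real.exp (l * f y) * (l * f y)) =
      fun y => l * (f y * Real.exp (l * f y)) := by ext y; ring
  have h1 := hA.local_logSobolev hd hρ hc hk ht
  have h2 := hA.act_exp_mul_le (hA.const_mul_mem α hG) hk ht.le
  rw [S.act_congr e1, e3] at h1
  rw [e2, e3] at h2
  obtain ⟨m, hm, hmk⟩ := hA.exists_le_act_exp hk
  filter_upwards [h1, h2, hmk t ht.le,
    S.act_const_mul (l ^ 2) (hA.memLp_two (hA.mul_mem hek hG)) t,
    S.act_const_mul α (hA.memLp_two (hA.mul_mem hek hG)) t,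
    S.act_const_mul l (hA.memLp_two (hA.mul_mem hf hek)) t] with x h1 h2 h3 h4 h5 h6
  rw [h4, h6] at h1
  rw [h5, h6] at h2
  set G := S.act t (fun y => Real.exp (l * f y)) x
  set Z := S.act t (fun y => Real.exp (α * S.carre f f y)) x
  set Y := S.act t (fun y => Real.exp (l * f y) * S.carre f f y) x
  set T := S.act t (fun y => f y * Real.exp (l * f y)) x
  have hG0 : 0 < G := hm.trans_le h3
  have hα0 : 0 < α := hc0.trans hα
  have hl2 : 0 < l ^ 2 := pow_pos hl.1 2
  have hl1 : l ^ 2 ≤ 1 := pow_le_one₀ hl.1.le hl.2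
  have hpos : 0 < α - c * l ^ 2 := by nlinarith
  -- `(α - c l²) Ent ≤ c l² G log Z`
  have h7 : (α - c * l ^ 2) * (l * T - G * Real.log G) ≤ c * l ^ 2 * (G * Real.log Z) := by
    have h8 := mul_le_mul_of_nonneg_left h1 hα0.le
    have h9 := mul_le_mul_of_nonneg_left h2 (mul_pos hc0 hl2).le
    linarith
  have h10 : l * (T / G) - Real.log G = (l * T - G * Real.log G) / G := by field_simp
  rw [h10, div_le_iff₀ hG0, div_mul_eq_mul_div, div_mul_eq_mul_div, le_div_iff₀ hpos]
  linarith

/-- The local exponential inequality, with the constant in the form `β artanh β`. Herbst's argument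
is run on the integrals `∫_E log P_t e^{l f} dμ` over an arbitrary measurable set `E`. -/
lemma log_act_exp_sub_le (hA : S.IsGoodFamily A) (hd : S.IsDiffusion A) {ρ α : ℝ} (hρ : 0 < ρ)
    (hc : S.HasCurvature A ρ) (hf : f ∈ A) (ht : 0 < t)
    (hα : (1 - Real.exp (-(2 * ρ * t))) / (2 * ρ) < α) :
    ∀ᵐ x ∂μ, Real.log (S.act t (fun y => Real.exp (f y)) x) - S.act t f x ≤
      bgConst ρ α t * Real.log (S.act t (fun y => Real.exp (α * S.carre f f y)) x) := by
  have hc0 : 0 < (1 - Real.exp (-(2 * ρ * t))) / (2 * ρ) := by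
    have : Real.exp (-(2 * ρ * t)) < 1 := by
      rw [Real.exp_lt_one_iff]
      have : 0 < 2 * ρ * t := by positivity
      linarith
    exact div_pos (by linarith) (by positivity)
  rw [bgConst_eq hρ ht hα]
  obtain ⟨C, hC0, hC⟩ := hA.exists_abs_le hf
  -- a lower bound of `P_t e^{l f}` which is uniform in `l ∈ [0, 1]`
  have hlow : ∀ l ∈ Set.Icc (0 : ℝ) 1,
      ∀ᵐ x ∂μ, Real.exp (-C) ≤ S.act t (fun y => Real.exp (l * f y)) x := by
    intro l hl
    refine S.le_act (hA.memLp_two (hA.exp_mem (hA.const_mul_mem l hf))) ?_ ht.le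
    filter_upwards [hC] with x hx
    refine Real.exp_le_exp.2 (neg_le_of_abs_le ?_)
    rw [abs_mul, abs_of_nonneg hl.1]
    nlinarith [hl.2, abs_nonneg (f x)]
  have hcurve := ((HasUniformDeriv.exp_mul (hA.aesm hf) hC).act S ht.le).log
    (Real.exp_pos (-C)) hlow
  obtain ⟨z, hz, hze⟩ := hA.exists_act_exp_eq (hA.const_mul_mem α (hA.carre_mem hf hf)) ht.le
  have hZi : Integrable
      (fun x => Real.log (S.act t (fun y => Real.exp (α * S.carre f f y)) x)) μ := by
    refine (hA.integrable hz).congr ?_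
    filter_upwards [hze] with x hx
    rw [hx, Real.log_exp]
  have h01 : (0 : ℝ) ∈ Set.Icc (0 : ℝ) 1 := ⟨le_rfl, zero_le_one⟩
  have h11 : (1 : ℝ) ∈ Set.Icc (0 : ℝ) 1 := ⟨zero_le_one, le_rfl⟩
  have hLi := hcurve.integrable h11
  simp only [one_mul] at hLi
  have hfi : Integrable (S.act t f) μ := (S.memLp_act t f).integrable one_le_two
  refine ae_le_of_forall_setIntegral_le (hLi.sub hfi) (hZi.const_mul _) fun E hE _ => ?_
  have hconst : S.act t (fun y => Real.exp (0 * f y)) =ᵐ[μ] fun _ => 1 := by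
    simp only [zero_mul, Real.exp_zero]
    exact S.act_const 1 ht.le
  have hN := fun l hl => (hcurve.restrict E).hasDerivWithinAt_integral (s := l) hl
  have hherbst := herbst_scalar hc0 hα
    (I := ∫ x in E, Real.log (S.act t (fun y => Real.exp (α * S.carre f f y)) x) ∂μ) (by
      refine integral_eq_zero_of_ae (ae_restrict_of_ae ?_)
      filter_upwards [hconst] with x hx
      rw [hx, Real.log_one]; rfl) hN (by
    intro l hl
    have hl' : l ∈ Set.Icc (0 : ℝ) 1 := ⟨hl.1.le, hl.2⟩
    have i1 := (hcurve.restrict E).integrable hl'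
    have i2 := ((hcurve.restrict E).integrable' hl').const_mul l
    rw [← integral_const_mul, ← integral_const_mul, ← integral_sub i2 i1]
    exact integral_mono_ae (i2.sub i1) (hZi.integrableOn.const_mul _)
      (ae_restrict_of_ae (hA.entropy_exp_mul_le hd hρ hc hf ht hc0 hα hl)))
  have e0 : ∫ x in E, S.act t (fun y => f y * Real.exp (0 * f y)) x /
      S.act t (fun y => Real.exp (0 * f y)) x ∂μ = ∫ x in E, S.act t f x ∂μ := by
    refine integral_congr_ae (ae_restrict_of_ae ?_)
    filter_upwards [hconst] with x hx
    rw [hx]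
    simp
  rw [e0] at hherbst
  simp only [one_mul] at hherbst
  rw [integral_const_mul]
  refine le_of_eq_of_le (integral_sub hLi.integrableOn hfi.integrableOn) hherbst

/-! ### Large times -/

/-- Convergence of `P_t f` to the mean, almost everywhere along a subsequence. -/
lemma exists_subseq_tendsto_act (hA : S.IsGoodFamily A) (hf : f ∈ A) {τ : ℕ → ℝ}
    (hτ : Tendsto τ atTop atTop) : ∃ ns : ℕ → ℕ, StrictMono ns ∧
      ∀ᵐ x ∂μ, Tendsto (fun i => S.act (τ (ns i)) f x) atTop (𝓝 (∫ y, f y ∂μ)) := by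
  have h1 : Tendsto (fun n => eLpNorm ((fun n => S.act (τ n) f) n - fun _ => ∫ y, f y ∂μ) 2 μ)
      atTop (𝓝 0) := (hA.ergodic f hf).comp hτ
  exact (tendstoInMeasure_of_tendsto_eLpNorm (by norm_num)
    (fun n => (S.memLp_act _ f).aestronglyMeasurable) aestronglyMeasurable_const
    h1).exists_seq_tendsto_ae

lemma integral_exp_le (hA : S.IsGoodFamily A) (hd : S.IsDiffusion A) {ρ α : ℝ} (hρ : 0 < ρ)
    (hc : S.HasCurvature A ρ) (hα : 1 / (2 * ρ) < α) (hf : f ∈ A) (hf0 : ∫ x, f x ∂μ = 0) :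
    ∫ x, Real.exp (f x) ∂μ ≤ (∫ x, Real.exp (α * S.carre f f x) ∂μ) ^ bgExponent ρ α := by
  have hef := hA.exp_mem hf
  have heG := hA.exp_mem (hA.const_mul_mem α (hA.carre_mem hf hf))
  have hτ : Tendsto (fun n : ℕ => (n : ℝ) + 1) atTop atTop :=
    tendsto_atTop_add_const_right _ _ tendsto_natCast_atTop_atTop
  obtain ⟨n₁, hn₁, h₁⟩ := hA.exists_subseq_tendsto_act hf hτ
  have hτ₁ := hτ.comp hn₁.tendsto_atTop
  obtain ⟨n₂, hn₂, h₂⟩ := hA.exists_subseq_tendsto_act hef hτ₁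
  have hτ₂ := hτ₁.comp hn₂.tendsto_atTop
  obtain ⟨n₃, hn₃, h₃⟩ := hA.exists_subseq_tendsto_act heG hτ₂
  have hτ₃ := hτ₂.comp hn₃.tendsto_atTop
  have hlocal : ∀ i : ℕ, ∀ᵐ x ∂μ, _ := fun i =>
    hA.log_act_exp_sub_le (t := ((n₁ (n₂ (n₃ i)) : ℕ) : ℝ) + 1) hd hρ hc hf (by positivity)
      (lt_of_le_of_lt (by
        have := Real.exp_pos (-(2 * ρ * (((n₁ (n₂ (n₃ i)) : ℕ) : ℝ) + 1)))
        gcongr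
        linarith) hα)
  obtain ⟨x, hx, hx₁, hx₂, hx₃⟩ := ((ae_all_iff.2 hlocal).and (h₁.and (h₂.and h₃))).exists
  have hpos : ∀ {g : X → ℝ}, g ∈ A → 0 < ∫ x, Real.exp (g x) ∂μ := fun hg =>
    integral_exp_pos (hA.integrable (hA.exp_mem hg))
  have hpf := hpos hf
  have hpG := hpos (hA.const_mul_mem α (hA.carre_mem hf hf))
  have l₁ := hx₁.comp (hn₂.tendsto_atTop.comp hn₃.tendsto_atTop)
  have l₂ := (hx₂.comp hn₃.tendsto_atTop).log hpf.ne'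
  have l₃ := hx₃.log hpG.ne'
  have l₄ := (tendsto_bgConst_atTop hρ hα).comp hτ₃
  have hlim := le_of_tendsto_of_tendsto' (l₂.sub l₁) (l₄.mul l₃) hx
  rw [hf0, sub_zero] at hlim
  rw [Real.rpow_def_of_pos hpG, ← Real.log_le_iff_le_exp hpf]
  linarith

end IsGoodFamily

end MarkovSemigroup

theorem mainTheorem4 {X : Type*} [MeasurableSpace X] (μ : Measure X) [IsProbabilityMeasure μ]
    (S : MarkovSemigroup μ) (A : Set (X → ℝ)) (hA : S.IsGoodFamily A) (hdiff : S.IsDiffusion A)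
    (ρ : ℝ) (hρ : 0 < ρ) (hcurv : S.HasCurvature A ρ) :
    (∀ f ∈ A, ∀ t : ℝ, 0 < t → ∀ α : ℝ,
      (Real.exp (2 * ρ * t) + Real.exp (-(2 * ρ * t)) - 2) /
          (2 * ρ * (Real.exp (2 * ρ * t) - 1)) < α →
        ∀ᵐ x ∂μ, Real.log (S.act t (fun y => Real.exp (f y)) x) - S.act t f x ≤
          bgConst ρ α t * Real.log (S.act t (fun y => Real.exp (α * S.carre f f y)) x)) ∧
    (∀ α : ℝ, 1 / (2 * ρ) < α → ∀ f ∈ A, ∫ x, f x ∂μ = 0 →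
      ∫ x, Real.exp (f x) ∂μ ≤
        (∫ x, Real.exp (α * S.carre f f x) ∂μ) ^ bgExponent ρ α) ∧
    (∀ α : ℝ, 1 / (2 * ρ) < α → bgExponent ρ α < 1 / (2 * ρ * α - 1)) := by
  refine ⟨fun f hf t ht α hα => hA.log_act_exp_sub_le hdiff hρ hcurv hf ht ?_,
    fun α hα f hf hf0 => hA.integral_exp_le hdiff hρ hcurv hα hf hf0,
    fun α hα => bgExponent_lt hρ hα⟩
  -- with `y = e^{2ρt}`, the threshold is `(y + 1/y - 2) / (2ρ(y - 1)) = (1 - 1/y) / (2ρ)`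
  refine lt_of_eq_of_lt ?_ hα
  have h1 : 1 < Real.exp (2 * ρ * t) := Real.one_lt_exp_iff.2 (by positivity)
  have h2 : Real.exp (2 * ρ * t) - 1 ≠ 0 := by linarith
  rw [Real.exp_neg]
  field_simp
  ring
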